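/- Let $A\in\mathbb{R}^{n\times d}$ have nonzero rows $A_1,\dots,A_n$ ($n\ge 1$), let $g:\mathbb{R}^d\to(-\infty,+\infty]$ and $h_i^*:\mathbb{R}\to(-\infty,+\infty]$ ($1\le i\le n$) be such that $g$ and $h^*(y)=\sum_{i=1}^n h_i^*(y^{(i)})$ are proper, convex and lower semicontinuous, and let $h(z)=\sum_{i=1}^n h_i(z^{(i)})$, where $h_i$ is the convex conjugate of $h_i^*$. Put $L(x,y)=\langle Ax,y\rangle-h^*(y)+g(x)$, and assume that $L$ has a saddle point, i.e. a pair $(x_\star,y_\star)$ with $L(x,y_\star)\ge L(x_\star,y_\star)\ge L(x_\star,y)$ for all $x\in\mathbb{R}^d$, $y\in\mathbb{R}^n$. All norms are Euclidean, and $\operatorname{prox}_{t,f}(v)=\arg\min_u\{f(u)+\frac1{2t}\|u-v\|^2\}$. Let $\gamma\in(0,1)$ and $$p^{(i)}=\frac{\|A_i\|}{\sum_{j=1}^n\|A_j\|},\qquad \tau=\frac{1}{\sum_{j=1}^n\|A_j\|},\qquad \sigma^{(i)}=\frac{\gamma}{\|A_i\|},\qquad P=\operatorname{diag}(p^{(1)},\dots,p^{(n)}).$$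 Given $x_0\in\operatorname{dom}g$ and $y_0\in\operatorname{dom}h^*$, the dense PURE-CD algorithm with extrapolation parameter $\theta=1$ computes, for $k=0,1,2,\dots$, $$\bar x_{k+1}=\operatorname{prox}_{\tau,g}(x_k-\tau A^\top y_k),$$ then picks $i_k\in\{1,\dots,n\}$ at random, independently of the previous picks, with $\Pr(i_k=i)=p^{(i)}$, and sets $$y_{k+1}^{(i_k)}=\operatorname{prox}_{\sigma^{(i_k)},h_{i_k}^*}\big(y_k^{(i_k)}+\sigma^{(i_k)}A_{i_k}\bar x_{k+1}\big),\qquad y_{k+1}^{(i)}=y_k^{(i)}\ (i\ne i_k),\qquad x_{k+1}=\bar x_{k+1}-\tau A^\top P^{-1}(y_{k+1}-y_k).$$ For $K\ge1$ let $x^K=\frac1K\sum_{k=1}^K\bar x_k$, and let $D_\star$ be the minimum of $\|x-x_0\|^2+\|y-y_0\|^2$ over all saddle points $(x,y)$ of $L$. Then, for every saddle point $(x_\star,y_\star)$ and every $K\ge 1$, the values $g(x_\star)$ and $g(x^K)$ are finite, the expectations below are those of integrable random variables, and the following holds. Case 1. If $h$ is real-valued and $L_h$-Lipschitz continuous, then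 $$\mathbb{E}\big[h(Ax^K)+g(x^K)-h(Ax_\star)-g(x_\star)\big]\le\frac{2\sum_{i=1}^n\|A_i\|}{K\gamma(1-\gamma)}\big(4L_h^2+\|x_\star-x_0\|^2\big).$$ Case 2. If $h=\delta_C$ (that is, $h=0$ on $C$ and $h=+\infty$ outside $C$) for a nonempty closed convex set $C=C_1\times\dots\times C_n\subseteq\mathbb{R}^n$, then $$\mathbb{E}\,|g(x^K)-g(x_\star)|\le\frac{8\sum_{i=1}^n\|A_i\|}{K\gamma(1-\gamma)}\Big[\big(\|x_\star-x_0\|+\|y_\star-y_0\|+\|y_0\|+\|y_\star\|\big)\|y_\star\|+D_\star+\|y_0\|^2\Big],$$ $$\mathbb{E}\,\operatorname{dist}(Ax^K,C)\le\frac{8\sum_{i=1}^n\|A_i\|}{K\gamma(1-\gamma)}\big(\|x_\star-x_0\|+\|y_\star-y_0\|+\|y_0\|+\|y_\star\|\big).$$ -/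

import Mathlib

open MeasureTheory ProbabilityTheory
open scoped NNReal

noncomputable section

namespace PureCD

/-- A proper, convex, lower semicontinuous function with values in `(-∞, +∞]`.
Convexity of an extended-valued function is convexity of its epigraph. -/
structure ProperConvexLsc {E : Type*} [NormedAddCommGroup E] [NormedSpace ℝ E]
    (f : E → EReal) : Prop where
  ne_bot : ∀ x, f x ≠ ⊥
  exists_ne_top : ∃ x, f x ≠ ⊤
  convex_epigraph : Convex ℝ {q : E × ℝ | f q.1 ≤ (q.2 : EReal)}
  lsc : LowerSemicontinuous f

/-- The proximal operator `prox_{τ, f}(v) = argmin_u f u + ‖u - v‖² / (2 τ)`.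
For `f` proper, convex, lower semicontinuous and `τ > 0` there is exactly one minimizer. -/
def prox {E : Type*} [NormedAddCommGroup E] (τ : ℝ) (f : E → EReal) (v : E) : E :=
  Classical.epsilon fun u =>
    ∀ w, f u + ((‖u - v‖ ^ 2 / (2 * τ) : ℝ) : EReal) ≤
      f w + ((‖w - v‖ ^ 2 / (2 * τ) : ℝ) : EReal)

/-- The convex conjugate of a function on the real line. -/
def conj (φ : ℝ → EReal) (t : ℝ) : EReal :=
  ⨆ s : ℝ, (((t * s : ℝ) : EReal) - φ s)

/-- The indicator function of convex analysis: `0` on `C` and `+∞` outside `C`. -/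
def indicator {E : Type*} (C : Set E) (z : E) : EReal :=
  open Classical in if z ∈ C then 0 else ⊤

variable {n d : ℕ}

/-- The separable function `z ↦ ∑ i, φ i (z i)`. -/
def separable (φ : Fin n → ℝ → EReal) (z : EuclideanSpace ℝ (Fin n)) : EReal :=
  ∑ i, φ i (z i)

/-- The linear map `x ↦ A x` between Euclidean spaces. -/
def app {m l : ℕ} (A : Matrix (Fin m) (Fin l) ℝ) (x : EuclideanSpace ℝ (Fin l)) :
    EuclideanSpace ℝ (Fin m) :=
  WithLp.toLp 2 (A.mulVec x.ofLp)

/-- The Euclidean norm `‖A_i‖` of the `i`-th row. -/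
def rowNorm (A : Matrix (Fin n) (Fin d) ℝ) (i : Fin n) : ℝ :=
  ‖(WithLp.toLp 2 (A i) : EuclideanSpace ℝ (Fin d))‖

/-- The Lagrangian `L(x, y) = ⟨A x, y⟩ - h*(y) + g(x)`, where `h*(y) = ∑ i, hs i (y i)`.
(Only pairs with `g x < ∞` and `h*(y) < ∞` can be saddle points when `g` and `h*` are proper,
so the convention for `∞ - ∞` is immaterial.) -/
def lagrangian (A : Matrix (Fin n) (Fin d) ℝ) (g : EuclideanSpace ℝ (Fin d) → EReal)
    (hs : Fin n → ℝ → EReal) (x : EuclideanSpace ℝ (Fin d)) (y : EuclideanSpace ℝ (Fin n)) :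
    EReal :=
  ((inner ℝ (app A x) y : ℝ) : EReal) - separable hs y + g x

/-- `(x', y')` is a saddle point (a primal-dual solution) of the Lagrangian. -/
def IsSaddle (A : Matrix (Fin n) (Fin d) ℝ) (g : EuclideanSpace ℝ (Fin d) → EReal)
    (hs : Fin n → ℝ → EReal) (x' : EuclideanSpace ℝ (Fin d)) (y' : EuclideanSpace ℝ (Fin n)) :
    Prop :=
  (∀ x, lagrangian A g hs x' y' ≤ lagrangian A g hs x y') ∧
    ∀ y, lagrangian A g hs x' y ≤ lagrangian A g hs x' y'

/-- `D⋆`: the least value of `‖x - x₀‖² + ‖y - y₀‖²` over all saddle points `(x, y)`. -/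
def distSol (A : Matrix (Fin n) (Fin d) ℝ) (g : EuclideanSpace ℝ (Fin d) → EReal)
    (hs : Fin n → ℝ → EReal) (x₀ : EuclideanSpace ℝ (Fin d)) (y₀ : EuclideanSpace ℝ (Fin n)) :
    ℝ :=
  sInf {r : ℝ | ∃ x y, IsSaddle A g hs x y ∧ r = ‖x - x₀‖ ^ 2 + ‖y - y₀‖ ^ 2}

/-- The data and (constant) parameters of a run of the dense algorithm:
primal step size `τ`, extrapolation parameter `θ`, dual step sizes `σ i`,
probabilities `p i`, initial point `(x₀, y₀)`. -/
structure Params (n d : ℕ) where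
  A : Matrix (Fin n) (Fin d) ℝ
  g : EuclideanSpace ℝ (Fin d) → EReal
  hs : Fin n → ℝ → EReal
  τ : ℝ
  θ : ℝ
  σ : Fin n → ℝ
  p : Fin n → ℝ
  x₀ : EuclideanSpace ℝ (Fin d)
  y₀ : EuclideanSpace ℝ (Fin n)

namespace Params

/-- `x̄_{k+1}` computed from `x_k = x` and `y_k = y`. -/
def xbarStep (S : Params n d) (x : EuclideanSpace ℝ (Fin d)) (y : EuclideanSpace ℝ (Fin n)) :
    EuclideanSpace ℝ (Fin d) :=
  prox S.τ S.g (x - S.τ • app S.A.transpose y)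

/-- `y_{k+1}` computed from `x_k = x`, `y_k = y` when the coordinate `i` is picked:
only that coordinate is changed, by a proximal step. -/
def yStep (S : Params n d) (i : Fin n) (x : EuclideanSpace ℝ (Fin d))
    (y : EuclideanSpace ℝ (Fin n)) : EuclideanSpace ℝ (Fin n) :=
  WithLp.toLp 2 (Function.update y.ofLp i
    (prox (S.σ i) (S.hs i) (y i + S.σ i * (app S.A (S.xbarStep x y)) i)))

/-- `x_{k+1} = x̄_{k+1} - τ θ Aᵀ P⁻¹ (y_{k+1} - y_k)`, with `P = diag(p)`. -/
def xStep (S : Params n d) (i : Fin n) (x : EuclideanSpace ℝ (Fin d))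
    (y : EuclideanSpace ℝ (Fin n)) : EuclideanSpace ℝ (Fin d) :=
  S.xbarStep x y - (S.τ * S.θ) • app S.A.transpose
    (WithLp.toLp 2 fun j => (S.p j)⁻¹ * ((S.yStep i x y) j - y j))

/-- The pair `(x_k, y_k)` when the coordinates `i 0, i 1, …` are picked. -/
def iterate (S : Params n d) (i : ℕ → Fin n) :
    ℕ → EuclideanSpace ℝ (Fin d) × EuclideanSpace ℝ (Fin n)
  | 0 => (S.x₀, S.y₀)
  | k + 1 =>
    (S.xStep (i k) (S.iterate i k).1 (S.iterate i k).2,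
      S.yStep (i k) (S.iterate i k).1 (S.iterate i k).2)

/-- The point `x̄_{k+1}` of the run (so `S.xbarSucc i 0` is `x̄_1`). -/
def xbarSucc (S : Params n d) (i : ℕ → Fin n) (k : ℕ) : EuclideanSpace ℝ (Fin d) :=
  S.xbarStep (S.iterate i k).1 (S.iterate i k).2

/-- The ergodic average `x^K = (1/K) ∑_{k=1}^K x̄_k`. -/
def xAvg (S : Params n d) (i : ℕ → Fin n) (K : ℕ) : EuclideanSpace ℝ (Fin d) :=
  (K : ℝ)⁻¹ • ∑ k ∈ Finset.range K, S.xbarSucc i k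

end Params

/-- Importance sampling and the step sizes belonging to it: `p i = ‖A_i‖ / ∑ ‖A_j‖`,
`τ = 1 / ∑ ‖A_j‖`, `σ i = γ / ‖A_i‖`, `θ = 1`. -/
def importanceParams (A : Matrix (Fin n) (Fin d) ℝ) (g : EuclideanSpace ℝ (Fin d) → EReal)
    (hs : Fin n → ℝ → EReal) (γ : ℝ) (x₀ : EuclideanSpace ℝ (Fin d))
    (y₀ : EuclideanSpace ℝ (Fin n)) : Params n d where
  A := A
  g := g
  hs := hs
  τ := 1 / ∑ j, rowNorm A j
  θ := 1
  σ := fun i => γ / rowNorm A i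
  p := fun i => rowNorm A i / ∑ j, rowNorm A j
  x₀ := x₀
  y₀ := y₀

/-- `h` is real-valued and Lipschitz with constant `L` for the Euclidean norm. -/
def IsLipschitzReal (L : ℝ≥0) (h : EuclideanSpace ℝ (Fin n) → EReal) : Prop :=
  ∃ f : EuclideanSpace ℝ (Fin n) → ℝ, (∀ z, h z = (f z : EReal)) ∧ LipschitzWith L f

end PureCD

end

/-! Write R for the sum of the row norms. The distance V = R/2 ‖x_k - x‖² + R/(2γ) ‖y_k - v‖² to a
fixed pair (x, v) is a Lyapunov function. Adding the prox inequalities of g and of all h_i^*, the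
mean drop of V in one step dominates g(x̄) - g(x) - c + ⟨A x̄, v⟩ - h*(v), where c bounds y ↦ ⟨A x,
y⟩ - h*(y), plus (1 - γ) R/(2γ) times the mean of ‖y_{k+1} - y_k‖² (`Admissible.one_step`).

The quantities to be estimated are suprema of this gap over v, so v has to depend on the run, and
expectation does not commute with the supremum. However, the drop of V is affine in v and involves
it only through ⟨y_{k+1} - y_k, v⟩ (`lyapunov_sub_eq`). Each dual increment is split into its
conditional mean and a martingale increment, the latter summing to a noise N_k. Telescoping along a
single run bounds the gap of the average for all v at once, and ‖v‖ ‖N_K‖ is the only random term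
containing v (`Admissible.pathwise_gap`). With a saddle point in V the gap is nonnegative, so V + (1
- γ) R/(2γ) ‖N_k‖² is a supermartingale and the second moment of N_K is bounded uniformly in K
(`Admissible.integral_noise_sq_le`). Division by K gives the O(1/K) rate of
`Admissible.expected_gap`.

The three estimates differ in the choice of v. If h is Lipschitz, the domain of h* is bounded and
the supremum over v recovers h(A u). If h is the indicator of C, then h* is at most the support
function of C (`separable_le_support`), so a suitable v of norm at most r yields g(u) - g(x) + r
dist(A u, C), while the saddle inequality gives g(u) - g(x⋆) ≥ -‖y⋆‖ dist(A u, C). Taking r > ‖y⋆‖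
controls the distance, and r = 2‖y⋆‖ controls the objective. -/

namespace PureCD


/-! ### Existence and first-order optimality of proximal points -/

section Prox

variable {E : Type*} [NormedAddCommGroup E] [InnerProductSpace ℝ E] {f : E → EReal}

theorem ProperConvexLsc.coe_toReal (hf : ProperConvexLsc f) {x : E} (hx : f x ≠ ⊤) :
    ((f x).toReal : EReal) = f x :=
  EReal.coe_toReal hx (hf.ne_bot x)

theorem ProperConvexLsc.le_coe_iff (hf : ProperConvexLsc f) {x : E} {r : ℝ} :
    f x ≤ r ↔ f x ≠ ⊤ ∧ (f x).toReal ≤ r := by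
  constructor
  · intro h
    have hx : f x ≠ ⊤ := ne_top_of_le_ne_top (EReal.coe_ne_top r) h
    exact ⟨hx, by rwa [← EReal.coe_le_coe_iff, hf.coe_toReal hx]⟩
  · rintro ⟨hx, h⟩
    rwa [← hf.coe_toReal hx, EReal.coe_le_coe_iff]

theorem ProperConvexLsc.convexOn (hf : ProperConvexLsc f) :
    ConvexOn ℝ {x | f x ≠ ⊤} fun x => (f x).toReal := by
  have key : ∀ x, f x ≠ ⊤ → ∀ y, f y ≠ ⊤ → ∀ a b : ℝ, 0 ≤ a → 0 ≤ b → a + b = 1 →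
      f (a • x + b • y) ≠ ⊤ ∧
        (f (a • x + b • y)).toReal ≤ a * (f x).toReal + b * (f y).toReal := by
    intro x hx y hy a b ha hb hab
    have h := hf.convex_epigraph (x := (x, (f x).toReal)) (y := (y, (f y).toReal))
      (by simp [hf.coe_toReal hx]) (by simp [hf.coe_toReal hy]) ha hb hab
    exact hf.le_coe_iff.1 (by simpa using h)
  refine ⟨fun x hx y hy a b ha hb hab => (key x hx y hy a b ha hb hab).1, ?_⟩
  intro x hx y hy a b ha hb hab
  exact (key x hx y hy a b ha hb hab).2

/-- On a finite-dimensional space a proper convex lower semicontinuous function decays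
at most linearly. -/
theorem ProperConvexLsc.exists_linear_lower_bound [FiniteDimensional ℝ E]
    (hf : ProperConvexLsc f) (v : E) :
    ∃ a b : ℝ, 0 ≤ b ∧ ∀ u, f u ≠ ⊤ → a - b * ‖u - v‖ ≤ (f u).toReal := by
  obtain ⟨u₀, hu₀⟩ := hf.exists_ne_top
  have : ProperSpace E := FiniteDimensional.proper_real E
  obtain ⟨m, hm, hmin⟩ := LowerSemicontinuousOn.exists_isMinOn
    (Metric.nonempty_closedBall.2 zero_le_one) (isCompact_closedBall u₀ 1)
    (hf.lsc.lowerSemicontinuousOn _)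
  have hle : f m ≤ f u₀ := hmin (Metric.mem_closedBall_self zero_le_one)
  have hm' : f m ≠ ⊤ := ne_top_of_le_ne_top hu₀ hle
  have hle' : (f m).toReal ≤ (f u₀).toReal := EReal.toReal_le_toReal hle (hf.ne_bot _) hu₀
  have hb : 0 ≤ (f u₀).toReal - (f m).toReal := sub_nonneg.2 hle'
  have hlow : ∀ u, f u ≠ ⊤ →
      (f m).toReal - ((f u₀).toReal - (f m).toReal) * ‖u - u₀‖ ≤ (f u).toReal := by
    intro u hu
    rcases le_or_gt ‖u - u₀‖ 1 with h1 | h1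
    · have : f m ≤ f u := hmin (by simpa [dist_eq_norm] using h1)
      have := EReal.toReal_le_toReal this (hf.ne_bot _) hu
      nlinarith [norm_nonneg (u - u₀)]
    -- Beyond the unit ball, convexity on the segment from `u₀` to `u`, tested at its point at
    -- distance 1, bounds the rate of descent by `f u₀ - f m`.
    · set ρ := ‖u - u₀‖ with hρ
      have hρ0 : 0 < ρ := by linarith
      have hw : f m ≤ f ((1 - ρ⁻¹) • u₀ + ρ⁻¹ • u) := by
        refine hmin ?_
        have : (1 - ρ⁻¹) • u₀ + ρ⁻¹ • u - u₀ = ρ⁻¹ • (u - u₀) := by module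
        rw [Metric.mem_closedBall, dist_eq_norm, this, norm_smul, Real.norm_eq_abs,
          abs_of_pos (inv_pos.2 hρ0), ← hρ, inv_mul_cancel₀ hρ0.ne']
      have h01 : 0 ≤ 1 - ρ⁻¹ := sub_nonneg.2 (inv_le_one_of_one_le₀ h1.le)
      have hc := hf.convexOn.2 hu₀ hu h01 (inv_pos.2 hρ0).le (by ring)
      have hd := hf.convexOn.1 hu₀ hu h01 (inv_pos.2 hρ0).le (by ring)
      have h3 := (EReal.toReal_le_toReal hw (hf.ne_bot _) hd).trans hc
      simp only [smul_eq_mul] at h3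
      have h4 := mul_le_mul_of_nonneg_left h3 hρ0.le
      have h5 : ρ * ((1 - ρ⁻¹) * (f u₀).toReal + ρ⁻¹ * (f u).toReal)
          = (ρ - 1) * (f u₀).toReal + (f u).toReal := by field_simp
      nlinarith
  refine ⟨(f m).toReal - ((f u₀).toReal - (f m).toReal) * ‖v - u₀‖,
    (f u₀).toReal - (f m).toReal, hb, fun u hu => ?_⟩
  have h1 := norm_sub_le_norm_sub_add_norm_sub u v u₀
  nlinarith [hlow u hu, mul_le_mul_of_nonneg_left h1 hb]

theorem ProperConvexLsc.exists_prox [FiniteDimensional ℝ E] (hf : ProperConvexLsc f)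
    {τ : ℝ} (hτ : 0 < τ) (v : E) :
    ∃ u, ∀ w, f u + ((‖u - v‖ ^ 2 / (2 * τ) : ℝ) : EReal) ≤
      f w + ((‖w - v‖ ^ 2 / (2 * τ) : ℝ) : EReal) := by
  obtain ⟨u₀, hu₀⟩ := hf.exists_ne_top
  obtain ⟨a, b, hb, hlow⟩ := hf.exists_linear_lower_bound v
  have : ProperSpace E := FiniteDimensional.proper_real E
  set q : E → ℝ := fun u => ‖u - v‖ ^ 2 / (2 * τ) with hq
  set e := |(f u₀).toReal + q u₀ - a| with he
  -- Outside this ball the quadratic is at least `(b + e) * ‖w - v‖`, so the objective is at least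
  -- `a + e`, which is at least its value at `u₀`. Minimizing over the ball is therefore enough.
  set r := max (max 1 (2 * τ * (b + e))) ‖u₀ - v‖ with hr
  have hlsc : LowerSemicontinuous fun u => f u + ((q u : ℝ) : EReal) := by
    refine hf.lsc.add' (Continuous.lowerSemicontinuous ?_) fun x => ?_
    · exact continuous_coe_real_ereal.comp (by fun_prop)
    · exact EReal.continuousAt_add (Or.inr (EReal.coe_ne_bot _)) (Or.inr (EReal.coe_ne_top _))
  have hu₀r : u₀ ∈ Metric.closedBall v r := by
    rw [Metric.mem_closedBall, dist_eq_norm]; exact le_max_right _ _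
  obtain ⟨u, hu, hmin⟩ := LowerSemicontinuousOn.exists_isMinOn
    ⟨u₀, hu₀r⟩ (isCompact_closedBall v r) (hlsc.lowerSemicontinuousOn _)
  refine ⟨u, fun w => ?_⟩
  by_cases hw : w ∈ Metric.closedBall v r
  · exact hmin hw
  by_cases hwt : f w = ⊤
  · rw [hwt, EReal.top_add_coe]; exact le_top
  refine (hmin hu₀r).trans ?_
  change f u₀ + ((q u₀ : ℝ) : EReal) ≤ f w + ((q w : ℝ) : EReal)
  rw [← hf.coe_toReal hu₀, ← hf.coe_toReal hwt, ← EReal.coe_add, ← EReal.coe_add,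
    EReal.coe_le_coe_iff]
  rw [Metric.mem_closedBall, dist_eq_norm, not_le] at hw
  have h1 : 1 ≤ ‖w - v‖ := ((le_max_left _ _).trans (le_max_left _ _)).trans hw.le
  have h2 : 2 * τ * (b + e) ≤ ‖w - v‖ := ((le_max_right _ _).trans (le_max_left _ _)).trans hw.le
  have h3 : (b + e) * ‖w - v‖ ≤ q w := by
    rw [hq]
    simp only
    rw [le_div_iff₀ (by positivity)]
    nlinarith
  have h4 := le_abs_self ((f u₀).toReal + q u₀ - a)
  have h5 : 0 ≤ e := abs_nonneg _
  nlinarith [hlow w hwt]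

theorem ProperConvexLsc.prox_spec [FiniteDimensional ℝ E] (hf : ProperConvexLsc f)
    {τ : ℝ} (hτ : 0 < τ) (v w : E) :
    f (prox τ f v) + ((‖prox τ f v - v‖ ^ 2 / (2 * τ) : ℝ) : EReal) ≤
      f w + ((‖w - v‖ ^ 2 / (2 * τ) : ℝ) : EReal) :=
  Classical.epsilon_spec (hf.exists_prox hτ v) w

theorem ProperConvexLsc.prox_ne_top [FiniteDimensional ℝ E] (hf : ProperConvexLsc f)
    {τ : ℝ} (hτ : 0 < τ) (v : E) : f (prox τ f v) ≠ ⊤ := by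
  obtain ⟨w, hw⟩ := hf.exists_ne_top
  intro h
  have := hf.prox_spec hτ v w
  rw [h, EReal.top_add_coe, ← hf.coe_toReal hw, ← EReal.coe_add, top_le_iff] at this
  exact EReal.coe_ne_top _ this

/-- Compare the prox point `u` with `(1 - t) • u + t • w`, use convexity, divide by `t` and let `t`
tend to 0. The quadratic remainder is `t * B` and disappears. -/
theorem ProperConvexLsc.prox_inequality [FiniteDimensional ℝ E] (hf : ProperConvexLsc f)
    {τ : ℝ} (hτ : 0 < τ) (v : E) {w : E} (hw : f w ≠ ⊤) :
    (f (prox τ f v)).toReal ≤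
      (f w).toReal + 1 / τ * inner ℝ (prox τ f v - v) (w - prox τ f v) := by
  set u := prox τ f v with hu
  have hut : f u ≠ ⊤ := hf.prox_ne_top hτ v
  set B := ‖w - u‖ ^ 2 / (2 * τ) with hB
  have key : ∀ t : ℝ, 0 < t → t ≤ 1 → (f u).toReal ≤
      (f w).toReal + 1 / τ * inner ℝ (u - v) (w - u) + t * B := by
    intro t ht ht1
    have hd := hf.convexOn.1 hut hw (sub_nonneg.2 ht1) ht.le (by ring)
    have hc := hf.convexOn.2 hut hw (sub_nonneg.2 ht1) ht.le (by ring)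
    have hs := hf.prox_spec hτ v ((1 - t) • u + t • w)
    rw [← hu, ← hf.coe_toReal hut, ← hf.coe_toReal hd, ← EReal.coe_add, ← EReal.coe_add,
      EReal.coe_le_coe_iff] at hs
    have hn : ‖(1 - t) • u + t • w - v‖ ^ 2 =
        ‖u - v‖ ^ 2 + 2 * (t * inner ℝ (u - v) (w - u)) + t ^ 2 * ‖w - u‖ ^ 2 := by
      have : (1 - t) • u + t • w - v = (u - v) + t • (w - u) := by module
      rw [this, norm_add_sq_real, inner_smul_right, norm_smul, mul_pow, Real.norm_eq_abs, sq_abs]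
    rw [hn] at hs
    simp only [smul_eq_mul] at hc
    have hs' : t * (f u).toReal ≤
        t * ((f w).toReal + 1 / τ * inner ℝ (u - v) (w - u) + t * B) := by
      have e1 : (‖u - v‖ ^ 2 + 2 * (t * inner ℝ (u - v) (w - u)) + t ^ 2 * ‖w - u‖ ^ 2) / (2 * τ)
          = ‖u - v‖ ^ 2 / (2 * τ) + t * (1 / τ * inner ℝ (u - v) (w - u)) + t * (t * B) := by
        rw [hB]; field_simp
      rw [e1] at hs
      linarith
    exact le_of_mul_le_mul_left hs' ht
  refine le_of_forall_pos_le_add fun ε hε => ?_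
  have hB0 : 0 ≤ B := by positivity
  have ht : 0 < min 1 (ε / (B + 1)) := lt_min one_pos (by positivity)
  have h2 : min 1 (ε / (B + 1)) * B ≤ ε := by
    calc min 1 (ε / (B + 1)) * B ≤ ε / (B + 1) * B := by gcongr; exact min_le_right _ _
      _ = ε * (B / (B + 1)) := by ring
      _ ≤ ε * 1 := by gcongr; rw [div_le_one (by positivity)]; linarith
      _ = ε := mul_one ε
  linarith [key _ ht (min_le_left _ _)]

end Prox


/-! ### Separable functions and their conjugates -/

theorem ereal_sum_coe {ι : Type*} (s : Finset ι) (f : ι → ℝ) :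
    ∑ i ∈ s, (f i : EReal) = ((∑ i ∈ s, f i : ℝ) : EReal) := by
  induction s using Finset.cons_induction with
  | empty => simp
  | cons a s ha ih => rw [Finset.sum_cons, Finset.sum_cons, ih, EReal.coe_add]

theorem ereal_sum_ne_bot_iff {ι : Type*} {s : Finset ι} {f : ι → EReal} :
    ∑ i ∈ s, f i ≠ ⊥ ↔ ∀ i ∈ s, f i ≠ ⊥ := by
  induction s using Finset.cons_induction with
  | empty => simp
  | cons a s ha ih =>
    rw [Finset.sum_cons, Ne, EReal.add_eq_bot_iff, not_or, Finset.forall_mem_cons]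
    exact and_congr Iff.rfl ih

theorem ereal_sum_ne_top_iff {ι : Type*} {s : Finset ι} {f : ι → EReal}
    (hb : ∀ i ∈ s, f i ≠ ⊥) : ∑ i ∈ s, f i ≠ ⊤ ↔ ∀ i ∈ s, f i ≠ ⊤ := by
  induction s using Finset.cons_induction with
  | empty => simp
  | cons a s ha ih =>
    rw [Finset.forall_mem_cons] at hb
    rw [Finset.sum_cons, EReal.add_ne_top_iff_ne_top₂ hb.1 (ereal_sum_ne_bot_iff.2 hb.2),
      Finset.forall_mem_cons]
    exact and_congr Iff.rfl (ih hb.2)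

variable {n : ℕ} {hs : Fin n → ℝ → EReal}

theorem hs_ne_bot (hh : ProperConvexLsc (separable hs)) (i : Fin n) (t : ℝ) : hs i t ≠ ⊥ :=
  ereal_sum_ne_bot_iff.1 (hh.ne_bot (WithLp.toLp 2 fun _ => t)) i (Finset.mem_univ i)

theorem separable_ne_top_iff (hh : ProperConvexLsc (separable hs))
    {y : EuclideanSpace ℝ (Fin n)} :
    separable hs y ≠ ⊤ ↔ ∀ i, hs i (y i) ≠ ⊤ := by
  rw [separable, ereal_sum_ne_top_iff fun i _ => hs_ne_bot hh i _]
  simp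

theorem separable_toReal (hh : ProperConvexLsc (separable hs))
    {y : EuclideanSpace ℝ (Fin n)} (hy : separable hs y ≠ ⊤) :
    (separable hs y).toReal = ∑ i, (hs i (y i)).toReal := by
  rw [← EReal.toReal_coe (∑ i, (hs i (y i)).toReal), ← ereal_sum_coe, separable]
  congr 1
  refine Finset.sum_congr rfl fun i _ => ?_
  rw [EReal.coe_toReal ((separable_ne_top_iff hh).1 hy i) (hs_ne_bot hh i _)]

/-- The vector `y` with its `i`-th coordinate replaced by `t`. -/
noncomputable def setCoord (y : EuclideanSpace ℝ (Fin n)) (i : Fin n) (t : ℝ) :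
    EuclideanSpace ℝ (Fin n) :=
  WithLp.toLp 2 (Function.update y.ofLp i t)

theorem setCoord_eq (y : EuclideanSpace ℝ (Fin n)) (i : Fin n) (t : ℝ) :
    setCoord y i t = y + EuclideanSpace.single i (t - y i) := by
  ext j
  by_cases h : j = i
  · subst h; simp [setCoord]
  · simp [setCoord, h]

theorem exists_separable_setCoord (hh : ProperConvexLsc (separable hs))
    {y : EuclideanSpace ℝ (Fin n)} (hy : separable hs y ≠ ⊤) (i : Fin n) :
    ∃ c : ℝ, ∀ t, separable hs (setCoord y i t) = hs i t + c := by
  refine ⟨∑ j ∈ Finset.univ.erase i, (hs j (y j)).toReal, fun t => ?_⟩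
  rw [separable, ← Finset.add_sum_erase _ _ (Finset.mem_univ i), ← ereal_sum_coe]
  congr 1
  · simp [setCoord]
  · refine Finset.sum_congr rfl fun j hj => ?_
    rw [EReal.coe_toReal ((separable_ne_top_iff hh).1 hy j) (hs_ne_bot hh j _)]
    simp [setCoord, Finset.ne_of_mem_erase hj]

/-- On a coordinate line through a point of the domain the sum equals `hs i` plus a finite constant,
so each component inherits the properties assumed only of the sum. -/
theorem properConvexLsc_component (hh : ProperConvexLsc (separable hs)) (i : Fin n) :
    ProperConvexLsc (hs i) := by
  obtain ⟨y, hy⟩ := hh.exists_ne_top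
  obtain ⟨c, hc⟩ := exists_separable_setCoord hh hy i
  have hc' : ∀ t, hs i t = separable hs (setCoord y i t) + ((-c : ℝ) : EReal) := by
    intro t
    rw [hc, add_assoc, ← EReal.coe_add, add_neg_cancel, EReal.coe_zero, add_zero]
  refine ⟨hs_ne_bot hh i, ⟨y i, (separable_ne_top_iff hh).1 hy i⟩, ?_, ?_⟩
  · have hle : ∀ t r : ℝ, hs i t ≤ r ↔ separable hs (setCoord y i t) ≤ ((r + c : ℝ) : EReal) := by
      intro t r
      rw [hc, EReal.coe_add]
      constructor
      · intro h
        gcongr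
      · intro h
        have h2 := add_le_add_left h ((-c : ℝ) : EReal)
        rwa [add_assoc, add_assoc, ← EReal.coe_add, add_neg_cancel, EReal.coe_zero, add_zero,
          add_zero] at h2
    rintro ⟨t, r⟩ ht ⟨t', r'⟩ ht' a b ha hb hab
    simp only [Set.mem_ofPred_eq, hle] at ht ht'
    have h := hh.convex_epigraph (x := (setCoord y i t, r + c)) (y := (setCoord y i t', r' + c))
      ht ht' ha hb hab
    have e1 : a • setCoord y i t + b • setCoord y i t' = setCoord y i (a • t + b • t') := by
      have hb' : b = 1 - a := by linarith
      subst hb'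
      ext j
      by_cases hj : j = i
      · subst hj; simp [setCoord]
      · simp [setCoord, hj]; ring
    have e2 : a * (r + c) + b * (r' + c) = (a * r + b * r') + c := by
      have hb' : b = 1 - a := by linarith
      subst hb'; ring
    simp only [Set.mem_ofPred_eq, Prod.smul_mk, Prod.mk_add_mk] at h ⊢
    rw [e1] at h
    simp only [smul_eq_mul] at h ⊢
    rw [e2] at h
    exact (hle _ _).2 h
  · have hcont : Continuous fun t => setCoord y i t := by
      simp only [setCoord_eq]
      have : ∀ t : ℝ, EuclideanSpace.single i (t - y i)
          = (t - y i) • EuclideanSpace.single (𝕜 := ℝ) i (1 : ℝ) := by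
        intro t; ext j; simp
      simp only [this]
      fun_prop
    have : hs i = fun t => separable hs (setCoord y i t) + ((-c : ℝ) : EReal) := funext hc'
    rw [this]
    refine LowerSemicontinuous.add' (hh.lsc.comp hcont)
      lowerSemicontinuous_const fun x => ?_
    exact EReal.continuousAt_add (Or.inr (EReal.coe_ne_bot _)) (Or.inr (EReal.coe_ne_top _))

theorem inner_eq_sum (z y : EuclideanSpace ℝ (Fin n)) : inner ℝ z y = ∑ i, z i * y i := by
  simp [PiLp.inner_apply, mul_comm]

theorem inner_sub_le_separable_conj (hh : ProperConvexLsc (separable hs))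
    (z : EuclideanSpace ℝ (Fin n)) {y : EuclideanSpace ℝ (Fin n)} (hy : separable hs y ≠ ⊤) :
    ((inner ℝ z y - (separable hs y).toReal : ℝ) : EReal)
      ≤ separable (fun i => conj (hs i)) z := by
  rw [separable_toReal hh hy, inner_eq_sum, ← Finset.sum_sub_distrib, ← ereal_sum_coe, separable]
  refine Finset.sum_le_sum fun i _ => ?_
  rw [EReal.coe_sub, EReal.coe_toReal ((separable_ne_top_iff hh).1 hy i) (hs_ne_bot hh i _)]
  exact le_iSup (fun s : ℝ => (((z i * s : ℝ) : EReal) - hs i s)) (y i)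

theorem separable_conj_ne_bot (hh : ProperConvexLsc (separable hs))
    (z : EuclideanSpace ℝ (Fin n)) : separable (fun i => conj (hs i)) z ≠ ⊥ := by
  obtain ⟨y, hy⟩ := hh.exists_ne_top
  exact ne_bot_of_le_ne_bot (EReal.coe_ne_bot _) (inner_sub_le_separable_conj hh z hy)

/-- The conjugate of a separable sum is the sum of the conjugates. Moving one coordinate at a time
shows that every summand is finite; then nearly optimal coordinates are assembled into one vector.
-/
theorem separable_conj_le (hh : ProperConvexLsc (separable hs))
    {z : EuclideanSpace ℝ (Fin n)} {B : ℝ}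
    (hB : ∀ y, separable hs y ≠ ⊤ → inner ℝ z y - (separable hs y).toReal ≤ B) :
    separable (fun i => conj (hs i)) z ≤ B := by
  obtain ⟨y, hy⟩ := hh.exists_ne_top
  have hbot : ∀ i, conj (hs i) (z i) ≠ ⊥ := fun i =>
    ereal_sum_ne_bot_iff.1 (separable_conj_ne_bot hh z) i (Finset.mem_univ i)
  have htop : ∀ i, conj (hs i) (z i) ≠ ⊤ := by
    intro i
    obtain ⟨c, hc⟩ := exists_separable_setCoord hh hy i
    have hle : conj (hs i) (z i) ≤ ((B + c - inner ℝ z y + z i * y i : ℝ) : EReal) := by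
      refine iSup_le fun s => ?_
      by_cases hst : hs i s = ⊤
      · rw [hst, EReal.sub_top]; exact bot_le
      have hb := hs_ne_bot hh i s
      have hne : separable hs (setCoord y i s) ≠ ⊤ := by
        rw [hc, ← EReal.coe_toReal hst hb, ← EReal.coe_add]; exact EReal.coe_ne_top _
      have h := hB _ hne
      rw [hc, EReal.toReal_add hst hb (EReal.coe_ne_top _) (EReal.coe_ne_bot _),
        EReal.toReal_coe, setCoord_eq, inner_add_right] at h
      have e : inner ℝ z (EuclideanSpace.single i (s - y i)) = z i * (s - y i) := by
        simp [EuclideanSpace.inner_single_right, mul_comm]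
      rw [e] at h
      rw [← EReal.coe_toReal hst hb, ← EReal.coe_sub, EReal.coe_le_coe_iff]
      linarith
    exact ne_top_of_le_ne_top (EReal.coe_ne_top _) hle
  have hsum : separable (fun i => conj (hs i)) z
      = ((∑ i, (conj (hs i) (z i)).toReal : ℝ) : EReal) := by
    rw [← ereal_sum_coe, separable]
    exact Finset.sum_congr rfl fun i _ => (EReal.coe_toReal (htop i) (hbot i)).symm
  rw [hsum, EReal.coe_le_coe_iff]
  refine le_of_forall_pos_le_add fun ε hε => ?_
  -- The denominator `n + 1` keeps δ positive also for `n = 0`.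
  set δ := ε / (n + 1) with hδ
  have hδ0 : 0 < δ := by positivity
  have hex : ∀ i, ∃ s : ℝ, hs i s ≠ ⊤ ∧
      (conj (hs i) (z i)).toReal - δ < z i * s - (hs i s).toReal := by
    intro i
    have hlt : (((conj (hs i) (z i)).toReal - δ : ℝ) : EReal) < conj (hs i) (z i) := by
      conv_rhs => rw [← EReal.coe_toReal (htop i) (hbot i)]
      rw [EReal.coe_lt_coe_iff]; linarith
    obtain ⟨s, hs'⟩ := lt_iSup_iff.1 hlt
    have hst : hs i s ≠ ⊤ := by
      intro h; rw [h, EReal.sub_top] at hs'; exact not_lt_bot hs'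
    refine ⟨s, hst, ?_⟩
    rwa [← EReal.coe_toReal hst (hs_ne_bot hh i s), ← EReal.coe_sub, EReal.coe_lt_coe_iff] at hs'
  choose s hst hs' using hex
  have hdom : separable hs (WithLp.toLp 2 s) ≠ ⊤ := (separable_ne_top_iff hh).2 hst
  have h := hB _ hdom
  rw [separable_toReal hh hdom, inner_eq_sum, ← Finset.sum_sub_distrib] at h
  have h2 : ∑ i, ((conj (hs i) (z i)).toReal - δ) ≤ ∑ i, (z i * s i - (hs i (s i)).toReal) :=
    Finset.sum_le_sum fun i _ => (hs' i).le
  rw [Finset.sum_sub_distrib, Finset.sum_const, Finset.card_univ, Fintype.card_fin,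
    nsmul_eq_mul] at h2
  have h3 : n * δ ≤ ε := by
    rw [hδ, mul_div_assoc', div_le_iff₀ (by positivity)]; nlinarith
  simp only at h
  linarith

/-- If `h*` is conjugate to the indicator of `C`, it is bounded by the support function of `C`. -/
theorem separable_le_support (hh : ProperConvexLsc (separable hs))
    {C : Set (EuclideanSpace ℝ (Fin n))} (hC : C.Nonempty)
    (hind : separable (fun i => conj (hs i)) = indicator C)
    {v : EuclideanSpace ℝ (Fin n)} {c : ℝ} (hv : ∀ z ∈ C, inner ℝ z v ≤ c) :
    separable hs v ≤ c := by
  obtain ⟨z', hz'⟩ := hC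
  set b := c - inner ℝ z' v with hb
  have hb0 : 0 ≤ b := sub_nonneg.2 (hv z' hz')
  -- Moreau regularization: `z = (v - y) / t` is a subgradient of `h*` at the prox point `y`.
  -- Equality in Fenchel-Young makes `h z` finite, hence `z ∈ C` and `h* y = ⟨z, y⟩ ≤ c - ‖y - v‖² /
  -- t`. The lower bound `h* y ≥ ⟨z', y⟩` then forces `y` towards `v` as `t` tends to 0, and lower
  -- semicontinuity concludes.
  have key : ∀ t : ℝ, 0 < t → separable hs (prox t (separable hs) v) ≤ c ∧
      ‖prox t (separable hs) v - v‖ ^ 2 ≤ t * (b + ‖z'‖ * ‖prox t (separable hs) v - v‖) := by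
    intro t ht
    set y := prox t (separable hs) v with hy
    have hyt : separable hs y ≠ ⊤ := hh.prox_ne_top ht v
    set z := (1 / t) • (v - y) with hz
    have hvar : ∀ w, separable hs w ≠ ⊤ →
        inner ℝ z w - (separable hs w).toReal ≤ inner ℝ z y - (separable hs y).toReal := by
      intro w hw
      have h := hh.prox_inequality ht v hw
      have e : inner ℝ z w - inner ℝ z y = - (1 / t * inner ℝ (y - v) (w - y)) := by
        rw [← inner_sub_right, hz, inner_smul_left, ← neg_sub y v, inner_neg_left]
        simp
      rw [← hy] at h
      linarith
    have heq : separable (fun i => conj (hs i)) z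
        = ((inner ℝ z y - (separable hs y).toReal : ℝ) : EReal) :=
      le_antisymm (separable_conj_le hh hvar) (inner_sub_le_separable_conj hh z hyt)
    have hzC : z ∈ C := by
      by_contra hzC
      rw [hind, indicator, if_neg hzC] at heq
      exact EReal.coe_ne_top _ heq.symm
    rw [hind, indicator, if_pos hzC, ← EReal.coe_zero, EReal.coe_eq_coe_iff] at heq
    have hzv : inner ℝ z (v - y) = ‖y - v‖ ^ 2 / t := by
      rw [hz, inner_smul_left, real_inner_self_eq_norm_sq, norm_sub_rev]
      simp only [conj_trivial]; ring
    have h1 := hv z hzC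
    rw [inner_sub_right] at hzv
    have hH : (separable hs y).toReal ≤ c - ‖y - v‖ ^ 2 / t := by linarith
    have h0 : 0 ≤ ‖y - v‖ ^ 2 / t := by positivity
    refine ⟨hh.le_coe_iff.2 ⟨hyt, by linarith⟩, ?_⟩
    have h2 := inner_sub_le_separable_conj hh z' hyt
    rw [hind, indicator, if_pos hz', ← EReal.coe_zero, EReal.coe_le_coe_iff] at h2
    have h3 : inner ℝ z' v - inner ℝ z' y ≤ ‖z'‖ * ‖y - v‖ := by
      rw [← inner_sub_right, norm_sub_rev]; exact real_inner_le_norm _ _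
    have h4 : ‖y - v‖ ^ 2 / t ≤ b + ‖z'‖ * ‖y - v‖ := by linarith
    rwa [div_le_iff₀ ht, mul_comm] at h4
  have hcl : IsClosed (separable hs ⁻¹' Set.Iic (c : EReal)) := hh.lsc.isClosed_preimage _
  change v ∈ separable hs ⁻¹' Set.Iic (c : EReal)
  rw [← hcl.closure_eq, Metric.mem_closure_iff]
  intro ε hε
  -- Chosen so that a distance `a ≥ ε` would give `a² (b + ‖z'‖ ε + 1) ≤ a² (b + ‖z'‖ ε)`.
  set t := ε ^ 2 / (b + ‖z'‖ * ε + 1) with ht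
  have hD : 0 < b + ‖z'‖ * ε + 1 := by positivity
  have ht0 : 0 < t := by positivity
  refine ⟨prox t (separable hs) v, (key t ht0).1, ?_⟩
  rw [dist_comm, dist_eq_norm]
  by_contra hcon
  rw [not_lt] at hcon
  have h := (key t ht0).2
  set a := ‖prox t (separable hs) v - v‖ with ha
  have h5 : a * (b + ‖z'‖ * ε + 1) * a ≤ ε * (ε * (b + ‖z'‖ * a)) := by
    have : t * (b + ‖z'‖ * ε + 1) = ε ^ 2 := by rw [ht]; field_simp
    nlinarith
  have h6 : ε * (b + ‖z'‖ * a) ≤ a * (b + ‖z'‖ * ε) := by nlinarith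
  have h7 : ε * (ε * (b + ‖z'‖ * a)) ≤ a * (a * (b + ‖z'‖ * ε)) := by
    apply mul_le_mul hcon h6 (by positivity) (by positivity)
  nlinarith


/-! ### Expectations of functions of finitely many random picks -/

section Path

variable {n : ℕ} {Ω : Type*} [MeasurableSpace Ω] {P : Measure Ω} {I : ℕ → Ω → Fin n}

theorem exists_eq_restrict_of_dependsOn {β : Type*} [Nonempty β] {k : ℕ} {F : (ℕ → Fin n) → β}
    (hF : DependsOn F (Finset.range k : Set ℕ)) :
    ∃ G : ((Finset.range k) → Fin n) → β, ∀ s, F s = G fun j => s j := by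
  obtain ⟨G, hG⟩ := dependsOn_iff_exists_comp.1 hF
  exact ⟨G, fun s => congrFun hG s⟩

/-- A function of the first `k` picks factors through a finite discrete space, so no measurability
or boundedness of `F` has to be checked. -/
theorem integrable_path {β : Type*} [NormedAddCommGroup β] [IsProbabilityMeasure P]
    (hI : ∀ k, Measurable (I k)) {k : ℕ} {F : (ℕ → Fin n) → β}
    (hF : DependsOn F (Finset.range k : Set ℕ)) :
    Integrable (fun ω => F fun j => I j ω) P := by
  obtain ⟨G, hG⟩ := exists_eq_restrict_of_dependsOn hF
  simp only [hG]
  have hm : Measurable fun ω => fun j : Finset.range k => I j ω :=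
    measurable_pi_lambda _ fun j => hI j
  have : IsProbabilityMeasure (P.map fun ω => fun j : Finset.range k => I j ω) :=
    Measure.isProbabilityMeasure_map hm.aemeasurable
  exact (Integrable.of_finite (f := G)).comp_measurable hm

theorem dependsOn_update {β : Type*} {k : ℕ} {F : (ℕ → Fin n) → β}
    (hF : DependsOn F (Finset.range (k + 1) : Set ℕ)) (i : Fin n) :
    DependsOn (fun s => F (Function.update s k i)) (Finset.range k : Set ℕ) := by
  intro s t hst
  refine hF fun j hj => ?_
  by_cases hjk : j = k
  · subst hjk; simp
  · rw [Function.update_of_ne hjk, Function.update_of_ne hjk]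
    refine hst j ?_
    simp only [Finset.coe_range, Set.mem_Iio] at hj ⊢
    omega

theorem update_of_dependsOn {β : Type*} {k : ℕ} {F : (ℕ → Fin n) → β}
    (hF : DependsOn F (Finset.range k : Set ℕ)) (s : ℕ → Fin n) (i : Fin n) :
    F (Function.update s k i) = F s := by
  refine hF fun j hj => Function.update_of_ne ?_ _ _
  simp only [Finset.coe_range, Set.mem_Iio] at hj
  omega

/-- Averaging over the last pick does not change the expectation. -/
theorem integral_path_succ [IsProbabilityMeasure P] (hI : ∀ k, Measurable (I k))
    (hindep : iIndepFun I P) {p : Fin n → ℝ} (hlaw : ∀ k i, P.real {ω | I k ω = i} = p i)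
    {k : ℕ} {F : (ℕ → Fin n) → ℝ} (hF : DependsOn F (Finset.range (k + 1) : Set ℕ)) :
    ∫ ω, F (fun j => I j ω) ∂P =
      ∫ ω, ∑ i, p i * F (Function.update (fun j => I j ω) k i) ∂P := by
  have hset : ∀ i, MeasurableSet {ω | I k ω = i} := fun i => hI k (measurableSet_singleton i)
  have hdec : ∀ ω, F (fun j => I j ω) = ∑ i, F (Function.update (fun j => I j ω) k i) *
      {ω | I k ω = i}.indicator (fun _ => (1 : ℝ)) ω := by
    intro ω
    rw [Finset.sum_eq_single (I k ω)]
    · simp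
    · intro i _ hi
      simp [Set.indicator, Ne.symm hi]
    · simp
  have hint : ∀ i, Integrable (fun ω => F (Function.update (fun j => I j ω) k i)) P := fun i =>
    integrable_path (F := fun s => F (Function.update s k i)) hI (dependsOn_update hF i)
  -- Once pick `k` is frozen at `i`, the value depends only on the earlier picks and is independent
  -- of the event `I k = i`.
  have hind : ∀ i, IndepFun (fun ω => F (Function.update (fun j => I j ω) k i))
      ({ω | I k ω = i}.indicator fun _ => (1 : ℝ)) P := by
    intro i
    obtain ⟨G, hG⟩ := exists_eq_restrict_of_dependsOn (dependsOn_update hF i)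
    have h := hindep.indepFun_finset (Finset.range k) {k} (by simp) hI
    have h2 := h.comp (φ := G)
      (ψ := fun u => if u ⟨k, by simp⟩ = i then (1 : ℝ) else 0)
      Measurable.of_discrete Measurable.of_discrete
    convert h2 using 1
    · funext ω
      exact hG fun j => I j ω
    · funext ω
      by_cases hω : I k ω = i <;> simp [Set.indicator, hω]
  have hmul : ∀ i, ∫ ω, F (Function.update (fun j => I j ω) k i) *
      {ω | I k ω = i}.indicator (fun _ => (1 : ℝ)) ω ∂P
      = p i * ∫ ω, F (Function.update (fun j => I j ω) k i) ∂P := by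
    intro i
    rw [(hind i).integral_fun_mul_eq_mul_integral (hint i).aestronglyMeasurable
      (measurable_const.indicator (hset i)).aestronglyMeasurable, integral_indicator_const _ (hset i),
      hlaw, smul_eq_mul, mul_one, mul_comm]
  have hint2 : ∀ i, Integrable (fun ω => F (Function.update (fun j => I j ω) k i) *
      {ω | I k ω = i}.indicator (fun _ => (1 : ℝ)) ω) P := by
    intro i
    have : (fun ω => F (Function.update (fun j => I j ω) k i) *
        {ω | I k ω = i}.indicator (fun _ => (1 : ℝ)) ω)
        = {ω | I k ω = i}.indicator fun ω => F (Function.update (fun j => I j ω) k i) := by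
      funext ω; by_cases h : I k ω = i <;> simp [Set.indicator, h]
    rw [this]
    exact (hint i).indicator (hset i)
  simp_rw [hdec]
  rw [integral_finsetSum _ fun i _ => hint2 i]
  rw [integral_finsetSum _ fun i _ => (hint i).const_mul (p i)]
  exact Finset.sum_congr rfl fun i _ => by rw [hmul, integral_const_mul]

/-- A supermartingale has decreasing expectation. -/
theorem integral_path_le_of_supermartingale [IsProbabilityMeasure P]
    (hI : ∀ k, Measurable (I k)) (hindep : iIndepFun I P) {p : Fin n → ℝ}
    (hlaw : ∀ k i, P.real {ω | I k ω = i} = p i) {F : ℕ → (ℕ → Fin n) → ℝ}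
    (hF : ∀ k, DependsOn (F k) (Finset.range k : Set ℕ))
    (hle : ∀ k s, ∑ i, p i * F (k + 1) (Function.update s k i) ≤ F k s)
    {c : ℝ} (h0 : ∀ s, F 0 s = c) (K : ℕ) :
    ∫ ω, F K (fun j => I j ω) ∂P ≤ c := by
  induction K with
  | zero => simp [h0]
  | succ k ih =>
    rw [integral_path_succ hI hindep hlaw (hF (k + 1))]
    refine le_trans (integral_mono ?_ (integrable_path hI (hF k)) fun ω => hle k _) ih
    exact integrable_finsetSum _ fun i _ => (integrable_path
      (F := fun s => F (k + 1) (Function.update s k i)) hI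
      (dependsOn_update (hF (k + 1)) i)).const_mul (p i)

end Path


/-! ### The one-step Lyapunov estimate -/

section Step

variable {n d : ℕ}

/-- The `i`-th row of `A` as a Euclidean vector. -/
noncomputable def row (A : Matrix (Fin n) (Fin d) ℝ) (i : Fin n) : EuclideanSpace ℝ (Fin d) :=
  WithLp.toLp 2 (A i)

theorem norm_row (A : Matrix (Fin n) (Fin d) ℝ) (i : Fin n) : ‖row A i‖ = rowNorm A i := rfl

theorem app_apply (A : Matrix (Fin n) (Fin d) ℝ) (x : EuclideanSpace ℝ (Fin d)) (i : Fin n) :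
    app A x i = inner ℝ (row A i) x := by
  simp [app, row, PiLp.inner_apply, Matrix.mulVec, dotProduct, mul_comm]

theorem app_transpose (A : Matrix (Fin n) (Fin d) ℝ) (u : EuclideanSpace ℝ (Fin n)) :
    app A.transpose u = ∑ i, u i • row A i := by
  ext j
  simp [app, row, Matrix.mulVec, dotProduct, mul_comm]

theorem app_smul (A : Matrix (Fin n) (Fin d) ℝ) (c : ℝ) (x : EuclideanSpace ℝ (Fin d)) :
    app A (c • x) = c • app A x := by
  ext i; simp [app_apply, inner_smul_right]

theorem app_sum (A : Matrix (Fin n) (Fin d) ℝ) {ι : Type*} (s : Finset ι)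
    (x : ι → EuclideanSpace ℝ (Fin d)) : app A (∑ j ∈ s, x j) = ∑ j ∈ s, app A (x j) := by
  ext i; simp [app_apply, inner_sum]

theorem rowNorm_pos {A : Matrix (Fin n) (Fin d) ℝ} (hA : ∀ i, A i ≠ 0) (i : Fin n) :
    0 < rowNorm A i := by
  rw [← norm_row, norm_pos_iff]
  intro h
  exact hA i (congrArg WithLp.ofLp h)

/-- The standing assumptions on the problem data; `R` is the sum of the row norms. -/
structure Admissible (A : Matrix (Fin n) (Fin d) ℝ) (g : EuclideanSpace ℝ (Fin d) → EReal)
    (hs : Fin n → ℝ → EReal) (γ R : ℝ) : Prop where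
  row_ne : ∀ i, A i ≠ 0
  primal : ProperConvexLsc g
  dual : ProperConvexLsc (separable hs)
  γ_pos : 0 < γ
  γ_lt : γ < 1
  sum_eq : ∑ j, rowNorm A j = R
  sum_pos : 0 < R

/-- The Lyapunov function of the algorithm relative to the point `(x, v)`. -/
noncomputable def lyapunov (γ R : ℝ) (x : EuclideanSpace ℝ (Fin d)) (v : EuclideanSpace ℝ (Fin n))
    (z : EuclideanSpace ℝ (Fin d) × EuclideanSpace ℝ (Fin n)) : ℝ :=
  R / 2 * ‖z.1 - x‖ ^ 2 + R / (2 * γ) * ‖z.2 - v‖ ^ 2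

/-- One step of the algorithm when the coordinate `i` is picked. -/
noncomputable def Params.step (S : Params n d) (i : Fin n)
    (z : EuclideanSpace ℝ (Fin d) × EuclideanSpace ℝ (Fin n)) :
    EuclideanSpace ℝ (Fin d) × EuclideanSpace ℝ (Fin n) :=
  (S.xStep i z.1 z.2, S.yStep i z.1 z.2)

/-- The change of the `i`-th dual coordinate when it is picked. -/
noncomputable def Params.dualIncr (S : Params n d) (i : Fin n)
    (z : EuclideanSpace ℝ (Fin d) × EuclideanSpace ℝ (Fin n)) : ℝ :=
  prox (S.σ i) (S.hs i) (z.2 i + S.σ i * (app S.A (S.xbarStep z.1 z.2)) i) - z.2 i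

theorem Params.yStep_eq (S : Params n d) (i : Fin n)
    (z : EuclideanSpace ℝ (Fin d) × EuclideanSpace ℝ (Fin n)) :
    S.yStep i z.1 z.2 = z.2 + EuclideanSpace.single i (S.dualIncr i z) :=
  setCoord_eq z.2 i _

theorem Params.xStep_eq (S : Params n d) (i : Fin n)
    (z : EuclideanSpace ℝ (Fin d) × EuclideanSpace ℝ (Fin n)) :
    S.xStep i z.1 z.2 = S.xbarStep z.1 z.2 -
      (S.τ * S.θ * ((S.p i)⁻¹ * S.dualIncr i z)) • row S.A i := by
  rw [Params.xStep, app_transpose, mul_smul (S.τ * S.θ)]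
  congr 2
  rw [Finset.sum_eq_single i]
  · simp [Params.yStep_eq]
  · intro j _ hj
    simp [Params.yStep_eq, hj]
  · simp

variable {A : Matrix (Fin n) (Fin d) ℝ} {g : EuclideanSpace ℝ (Fin d) → EReal}
  {hs : Fin n → ℝ → EReal} {γ R : ℝ} {x₀ : EuclideanSpace ℝ (Fin d)}
  {y₀ : EuclideanSpace ℝ (Fin n)}

theorem Admissible.sum_p (hS : Admissible A g hs γ R) :
    ∑ i, (importanceParams A g hs γ x₀ y₀).p i = 1 := by
  simp only [importanceParams]
  rw [← Finset.sum_div, hS.sum_eq, div_self hS.sum_pos.ne']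

theorem Admissible.p_nonneg (hS : Admissible A g hs γ R) (i : Fin n) :
    0 ≤ (importanceParams A g hs γ x₀ y₀).p i := by
  simp only [importanceParams, hS.sum_eq]
  exact div_nonneg (rowNorm_pos hS.row_ne i).le hS.sum_pos.le

theorem Admissible.primal_inequality (hS : Admissible A g hs γ R)
    (z : EuclideanSpace ℝ (Fin d) × EuclideanSpace ℝ (Fin n))
    {x : EuclideanSpace ℝ (Fin d)} (hx : g x ≠ ⊤) :
    (g ((importanceParams A g hs γ x₀ y₀).xbarStep z.1 z.2)).toReal ≤ (g x).toReal
      + R / 2 * (‖z.1 - x‖ ^ 2 - ‖(importanceParams A g hs γ x₀ y₀).xbarStep z.1 z.2 - x‖ ^ 2)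
      - ∑ i, (app A ((importanceParams A g hs γ x₀ y₀).xbarStep z.1 z.2) i - app A x i)
        * z.2 i := by
  have hR := hS.sum_pos
  have h := hS.primal.prox_inequality (one_div_pos.2 hR) (z.1 - (1 / R) • app A.transpose z.2) hx
  have e0 : prox (1 / R) g (z.1 - (1 / R) • app A.transpose z.2)
      = (importanceParams A g hs γ x₀ y₀).xbarStep z.1 z.2 := by
    simp only [Params.xbarStep, importanceParams, hS.sum_eq]
  rw [e0] at h
  set u := (importanceParams A g hs γ x₀ y₀).xbarStep z.1 z.2
  have e1 : inner ℝ (app A.transpose z.2) (u - x) = ∑ i, (app A u i - app A x i) * z.2 i := by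
    rw [app_transpose, sum_inner]
    refine Finset.sum_congr rfl fun i _ => ?_
    rw [inner_smul_left, inner_sub_right, app_apply, app_apply]
    simp [mul_comm]
  have e2 : 1 / (1 / R) * inner ℝ (u - (z.1 - (1 / R) • app A.transpose z.2)) (x - u)
      = R * inner ℝ (u - z.1) (x - u) - inner ℝ (app A.transpose z.2) (u - x) := by
    have : u - (z.1 - (1 / R) • app A.transpose z.2)
        = (u - z.1) + (1 / R) • app A.transpose z.2 := by module
    rw [this, inner_add_left, inner_smul_left, ← neg_sub u x, inner_neg_right, inner_neg_right]
    simp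
    field_simp
    ring
  have e3 : ‖z.1 - x‖ ^ 2 = ‖u - z.1‖ ^ 2 + 2 * inner ℝ (u - z.1) (x - u) + ‖u - x‖ ^ 2 := by
    have : z.1 - x = -((u - z.1) + (x - u)) := by abel
    rw [this, norm_neg, norm_add_sq_real, norm_sub_rev x u]
  rw [e2, e1] at h
  rw [e3]
  nlinarith [sq_nonneg ‖u - z.1‖]

theorem Admissible.dual_inequality (hS : Admissible A g hs γ R)
    (z : EuclideanSpace ℝ (Fin d) × EuclideanSpace ℝ (Fin n)) (i : Fin n) {t : ℝ}
    (ht : hs i t ≠ ⊤) :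
    hs i (z.2 i + (importanceParams A g hs γ x₀ y₀).dualIncr i z) ≠ ⊤ ∧
    (hs i (z.2 i + (importanceParams A g hs γ x₀ y₀).dualIncr i z)).toReal ≤ (hs i t).toReal
      + (rowNorm A i / γ * (importanceParams A g hs γ x₀ y₀).dualIncr i z
        - app A ((importanceParams A g hs γ x₀ y₀).xbarStep z.1 z.2) i)
        * (t - z.2 i - (importanceParams A g hs γ x₀ y₀).dualIncr i z) := by
  have hr := rowNorm_pos hS.row_ne i
  have hσ : 0 < γ / rowNorm A i := div_pos hS.γ_pos hr
  have hp := properConvexLsc_component hS.dual i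
  set a := app A ((importanceParams A g hs γ x₀ y₀).xbarStep z.1 z.2) i with ha
  have e0 : prox (γ / rowNorm A i) (hs i) (z.2 i + γ / rowNorm A i * a)
      = z.2 i + (importanceParams A g hs γ x₀ y₀).dualIncr i z := by
    rw [Params.dualIncr, add_sub_cancel]
    rfl
  have h1 := hp.prox_ne_top hσ (z.2 i + γ / rowNorm A i * a)
  have h2 := hp.prox_inequality hσ (z.2 i + γ / rowNorm A i * a) ht
  rw [e0] at h1 h2
  refine ⟨h1, h2.trans_eq ?_⟩
  have := hS.γ_pos
  simp only [RCLike.inner_apply, conj_trivial]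
  simp
  field_simp
  ring

/-- This is where the parameters are matched. Since `τ / p i = 1 / ‖A_i‖`, the correction of `x` has
norm `|D|` and costs `R / 2 * D ^ 2`, the fraction γ of the dual term `R / (2 * γ) * D ^ 2`; the
fraction `1 - γ` is left over. -/
theorem Admissible.lyapunov_step (hS : Admissible A g hs γ R) (x : EuclideanSpace ℝ (Fin d))
    (v : EuclideanSpace ℝ (Fin n))
    (z : EuclideanSpace ℝ (Fin d) × EuclideanSpace ℝ (Fin n)) (i : Fin n) {a b D : ℝ}
    (ha : app A ((importanceParams A g hs γ x₀ y₀).xbarStep z.1 z.2) i = a)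
    (hb : app A x i = b) (hD : (importanceParams A g hs γ x₀ y₀).dualIncr i z = D) :
    (importanceParams A g hs γ x₀ y₀).p i * (lyapunov γ R x v z
      - lyapunov γ R x v ((importanceParams A g hs γ x₀ y₀).step i z)
      - (1 - γ) * (R / (2 * γ)) * ‖((importanceParams A g hs γ x₀ y₀).step i z).2 - z.2‖ ^ 2)
    = (importanceParams A g hs γ x₀ y₀).p i * (R / 2 * (‖z.1 - x‖ ^ 2
        - ‖(importanceParams A g hs γ x₀ y₀).xbarStep z.1 z.2 - x‖ ^ 2))
      + (D * (a - b) + rowNorm A i / γ * D * (v i - z.2 i - D)) := by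
  have hr := rowNorm_pos hS.row_ne i
  have hR := hS.sum_pos
  have hγ := hS.γ_pos
  set u := (importanceParams A g hs γ x₀ y₀).xbarStep z.1 z.2 with hu
  have hx : ((importanceParams A g hs γ x₀ y₀).step i z).1 = u - (D / rowNorm A i) • row A i := by
    have e : (importanceParams A g hs γ x₀ y₀).τ * (importanceParams A g hs γ x₀ y₀).θ *
        (((importanceParams A g hs γ x₀ y₀).p i)⁻¹ * D) = D / rowNorm A i := by
      simp only [importanceParams, hS.sum_eq]
      field_simp
    rw [Params.step, Params.xStep_eq, hD, e, hu]
    rfl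
  have hy : ((importanceParams A g hs γ x₀ y₀).step i z).2 = z.2 + EuclideanSpace.single i D := by
    rw [Params.step, Params.yStep_eq, hD]
  have n1 : ‖((importanceParams A g hs γ x₀ y₀).step i z).1 - x‖ ^ 2
      = ‖u - x‖ ^ 2 - 2 * (D / rowNorm A i * (a - b)) + D ^ 2 := by
    rw [hx, sub_right_comm, norm_sub_sq_real, inner_smul_right, real_inner_comm, inner_sub_right,
      ← app_apply, ← app_apply, ha, hb, norm_smul, norm_row, mul_pow, Real.norm_eq_abs, sq_abs]
    field_simp
  have n2 : ‖((importanceParams A g hs γ x₀ y₀).step i z).2 - v‖ ^ 2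
      = ‖z.2 - v‖ ^ 2 + 2 * (D * (z.2 i - v i)) + D ^ 2 := by
    rw [hy, add_sub_right_comm, norm_add_sq_real, EuclideanSpace.inner_single_right]
    simp
  have n3 : ‖((importanceParams A g hs γ x₀ y₀).step i z).2 - z.2‖ ^ 2 = D ^ 2 := by
    rw [hy]; simp
  rw [lyapunov, lyapunov, n1, n2, n3]
  simp only [importanceParams, hS.sum_eq]
  field_simp
  ring

/-- The one-step estimate. -/
theorem Admissible.one_step (hS : Admissible A g hs γ R)
    {x : EuclideanSpace ℝ (Fin d)} (hx : g x ≠ ⊤) {c : ℝ}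
    (hc : ∀ y, separable hs y ≠ ⊤ → inner ℝ (app A x) y - (separable hs y).toReal ≤ c)
    {v : EuclideanSpace ℝ (Fin n)} (hv : separable hs v ≠ ⊤)
    (z : EuclideanSpace ℝ (Fin d) × EuclideanSpace ℝ (Fin n)) :
    (g ((importanceParams A g hs γ x₀ y₀).xbarStep z.1 z.2)).toReal - (g x).toReal - c
      + inner ℝ (app A ((importanceParams A g hs γ x₀ y₀).xbarStep z.1 z.2)) v
      - (separable hs v).toReal
    ≤ ∑ i, (importanceParams A g hs γ x₀ y₀).p i * (lyapunov γ R x v z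
      - lyapunov γ R x v ((importanceParams A g hs γ x₀ y₀).step i z)
      - (1 - γ) * (R / (2 * γ)) *
        ‖((importanceParams A g hs γ x₀ y₀).step i z).2 - z.2‖ ^ 2) := by
  have hvi := (separable_ne_top_iff hS.dual).1 hv
  have hd := fun i => hS.dual_inequality (x₀ := x₀) (y₀ := y₀) z i (hvi i)
  have hp := hS.primal_inequality (x₀ := x₀) (y₀ := y₀) z hx
  rw [Finset.sum_congr rfl fun i _ => hS.lyapunov_step x v z i rfl rfl rfl,
    Finset.sum_add_distrib, ← Finset.sum_mul, hS.sum_p, one_mul]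
  set S := importanceParams A g hs γ x₀ y₀
  set u := S.xbarStep z.1 z.2
  -- The virtual point in which all dual coordinates are updated at once. Averaging with the weights
  -- `p i` replaces the sampled coordinate by this full step, to which `hc` is applied.
  have hdom : separable hs (WithLp.toLp 2 fun i => z.2 i + S.dualIncr i z) ≠ ⊤ :=
    (separable_ne_top_iff hS.dual).2 fun i => (hd i).1
  have h1 := hc _ hdom
  rw [separable_toReal hS.dual hdom, inner_eq_sum, ← Finset.sum_sub_distrib] at h1
  rw [separable_toReal hS.dual hv, inner_eq_sum]
  have h2 := Finset.sum_le_sum fun i (_ : i ∈ Finset.univ) => (hd i).2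
  have h3 : ∑ i, ((hs i (v i)).toReal + (rowNorm A i / γ * S.dualIncr i z - app A u i)
        * (v i - z.2 i - S.dualIncr i z))
      = ∑ i, (hs i (v i)).toReal + ∑ i, (S.dualIncr i z * (app A u i - app A x i)
        + rowNorm A i / γ * S.dualIncr i z * (v i - z.2 i - S.dualIncr i z))
        + ∑ i, (app A u i - app A x i) * z.2 i - ∑ i, app A u i * v i
        + ∑ i, app A x i * (z.2 i + S.dualIncr i z) := by
    simp only [← Finset.sum_add_distrib, ← Finset.sum_sub_distrib]
    refine Finset.sum_congr rfl fun i _ => ?_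
    ring
  simp only [Finset.sum_sub_distrib] at h1
  linarith

/-- The term `‖v‖²` cancels in the difference. This linearity in `v` is what later admits a `v`
depending on the run. -/
theorem lyapunov_sub_eq (x : EuclideanSpace ℝ (Fin d)) (v : EuclideanSpace ℝ (Fin n))
    (z z' : EuclideanSpace ℝ (Fin d) × EuclideanSpace ℝ (Fin n)) :
    lyapunov γ R x v z - lyapunov γ R x v z' =
      lyapunov γ R x 0 z - lyapunov γ R x 0 z' + R / γ * inner ℝ (z'.2 - z.2) v := by
  have h : R / γ = 2 * (R / (2 * γ)) := by
    rw [mul_div_assoc', mul_div_mul_left _ _ two_ne_zero]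
  simp only [lyapunov, sub_zero]
  rw [norm_sub_sq_real z.2, norm_sub_sq_real z'.2, inner_sub_left, h]
  ring

end Step


/-- Centering removes the cross term with `m`, and a variance is at most the second moment. -/
theorem sum_mul_norm_add_sub_mean_sq_le {ι F : Type*} [Fintype ι] [NormedAddCommGroup F]
    [InnerProductSpace ℝ F] {p : ι → ℝ} (hp : ∑ i, p i = 1) (m : F) (Δ : ι → F) :
    ∑ i, p i * ‖m + (Δ i - ∑ j, p j • Δ j)‖ ^ 2 ≤ ‖m‖ ^ 2 + ∑ i, p i * ‖Δ i‖ ^ 2 := by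
  set e := ∑ j, p j • Δ j with he
  have h1 : ∀ i, p i * ‖m + (Δ i - e)‖ ^ 2 = p i * ‖m - e‖ ^ 2
      + 2 * inner ℝ (m - e) (p i • Δ i) + p i * ‖Δ i‖ ^ 2 := by
    intro i
    have : m + (Δ i - e) = (m - e) + Δ i := by abel
    rw [this, norm_add_sq_real, inner_smul_right]; ring
  simp only [h1, Finset.sum_add_distrib]
  rw [← Finset.sum_mul, hp, ← Finset.mul_sum, ← inner_sum, ← he, norm_sub_sq_real, inner_sub_left,
    real_inner_self_eq_norm_sq]
  nlinarith [sq_nonneg ‖e‖]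

/-! ### Consequences of the saddle point inequalities -/

section Saddle

variable {n d : ℕ} {A : Matrix (Fin n) (Fin d) ℝ} {g : EuclideanSpace ℝ (Fin d) → EReal}
  {hs : Fin n → ℝ → EReal} {xs : EuclideanSpace ℝ (Fin d)} {ys : EuclideanSpace ℝ (Fin n)}

theorem lagrangian_eq_coe (hg : ProperConvexLsc g) (hh : ProperConvexLsc (separable hs))
    {x : EuclideanSpace ℝ (Fin d)} {y : EuclideanSpace ℝ (Fin n)} (hx : g x ≠ ⊤)
    (hy : separable hs y ≠ ⊤) :
    lagrangian A g hs x y =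
      ((inner ℝ (app A x) y - (separable hs y).toReal + (g x).toReal : ℝ) : EReal) := by
  rw [lagrangian, EReal.coe_add, EReal.coe_sub, hg.coe_toReal hx, hh.coe_toReal hy]

theorem IsSaddle.dual_ne_top (hg : ProperConvexLsc g) (hh : ProperConvexLsc (separable hs))
    (hsol : IsSaddle A g hs xs ys) : separable hs ys ≠ ⊤ := by
  intro h
  obtain ⟨y, hy⟩ := hh.exists_ne_top
  have h1 := hsol.2 y
  rw [lagrangian, lagrangian, h, EReal.sub_top, EReal.bot_add, le_bot_iff,
    ← hh.coe_toReal hy, ← EReal.coe_sub, EReal.add_eq_bot_iff] at h1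
  exact h1.elim (EReal.coe_ne_bot _) (hg.ne_bot _)

theorem IsSaddle.primal_ne_top (hg : ProperConvexLsc g) (hh : ProperConvexLsc (separable hs))
    (hsol : IsSaddle A g hs xs ys) : g xs ≠ ⊤ := by
  intro h
  have hy := hsol.dual_ne_top hg hh
  obtain ⟨x, hx⟩ := hg.exists_ne_top
  have h1 := hsol.1 x
  rw [lagrangian_eq_coe hg hh hx hy, lagrangian, h, ← hh.coe_toReal hy, ← EReal.coe_sub,
    EReal.coe_add_top, top_le_iff] at h1
  exact EReal.coe_ne_top _ h1

theorem IsSaddle.primal_le (hg : ProperConvexLsc g) (hh : ProperConvexLsc (separable hs))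
    (hsol : IsSaddle A g hs xs ys) {x : EuclideanSpace ℝ (Fin d)} (hx : g x ≠ ⊤) :
    (g xs).toReal + inner ℝ (app A xs) ys ≤ (g x).toReal + inner ℝ (app A x) ys := by
  have hy := hsol.dual_ne_top hg hh
  have h := hsol.1 x
  rw [lagrangian_eq_coe hg hh hx hy, lagrangian_eq_coe hg hh (hsol.primal_ne_top hg hh) hy,
    EReal.coe_le_coe_iff] at h
  linarith

theorem IsSaddle.dual_le (hg : ProperConvexLsc g) (hh : ProperConvexLsc (separable hs))
    (hsol : IsSaddle A g hs xs ys) {y : EuclideanSpace ℝ (Fin n)} (hy : separable hs y ≠ ⊤) :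
    inner ℝ (app A xs) y - (separable hs y).toReal
      ≤ inner ℝ (app A xs) ys - (separable hs ys).toReal := by
  have hx := hsol.primal_ne_top hg hh
  have h := hsol.2 y
  rw [lagrangian_eq_coe hg hh hx hy, lagrangian_eq_coe hg hh hx (hsol.dual_ne_top hg hh),
    EReal.coe_le_coe_iff] at h
  linarith

theorem IsSaddle.separable_conj_eq (hg : ProperConvexLsc g) (hh : ProperConvexLsc (separable hs))
    (hsol : IsSaddle A g hs xs ys) : separable (fun i => conj (hs i)) (app A xs)
      = ((inner ℝ (app A xs) ys - (separable hs ys).toReal : ℝ) : EReal) :=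
  le_antisymm (separable_conj_le hh fun _ hy => hsol.dual_le hg hh hy)
    (inner_sub_le_separable_conj hh _ (hsol.dual_ne_top hg hh))

end Saddle

/-! ### Martingale decomposition and the expected gap along a run -/

section Run

variable {n d : ℕ}

theorem Params.iterate_succ (S : Params n d) (s : ℕ → Fin n) (k : ℕ) :
    S.iterate s (k + 1) = S.step (s k) (S.iterate s k) := rfl

theorem Params.dependsOn_iterate (S : Params n d) (k : ℕ) :
    DependsOn (fun s => S.iterate s k) (Finset.range k : Set ℕ) := by
  induction k with
  | zero => intro s t _; rfl
  | succ k ih =>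
    intro s t hst
    simp only [Params.iterate_succ]
    rw [hst k (by simp), show S.iterate s k = S.iterate t k from ih fun i hi => hst i (by
      simp only [Finset.coe_range, Set.mem_Iio] at hi ⊢; omega)]

theorem Params.iterate_update (S : Params n d) (s : ℕ → Fin n) (k : ℕ) (i : Fin n) :
    S.iterate (Function.update s k i) k = S.iterate s k :=
  update_of_dependsOn (S.dependsOn_iterate k) s i

theorem Params.iterate_update_succ (S : Params n d) (s : ℕ → Fin n) (k : ℕ) (i : Fin n) :
    S.iterate (Function.update s k i) (k + 1) = S.step i (S.iterate s k) := by
  rw [Params.iterate_succ, Params.iterate_update, Function.update_self]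

theorem dependsOn_sum_range {β : Type*} [AddCommMonoid β] {F : ℕ → (ℕ → Fin n) → β}
    (hF : ∀ k, DependsOn (F k) (Finset.range (k + 1) : Set ℕ)) (k : ℕ) :
    DependsOn (fun s => ∑ j ∈ Finset.range k, F j s) (Finset.range k : Set ℕ) := by
  intro s t hst
  refine Finset.sum_congr rfl fun j hj => hF j fun i hi => hst i ?_
  simp only [Finset.coe_range, Set.mem_Iio, Finset.mem_range] at hi hj ⊢
  omega

theorem Params.dependsOn_comp_iterate {β : Type*} (S : Params n d)
    (φ : EuclideanSpace ℝ (Fin d) × EuclideanSpace ℝ (Fin n) → β) (k : ℕ) :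
    DependsOn (fun s => φ (S.iterate s k)) (Finset.range k : Set ℕ) :=
  fun _ _ hst => congrArg φ (S.dependsOn_iterate k hst)

theorem dependsOn_range_mono {β : Type*} {k l : ℕ} (hkl : k ≤ l) {F : (ℕ → Fin n) → β}
    (hF : DependsOn F (Finset.range k : Set ℕ)) : DependsOn F (Finset.range l : Set ℕ) :=
  hF.mono (by simpa using hkl)

theorem Params.dependsOn_xAvg (S : Params n d) (K : ℕ) :
    DependsOn (fun s => S.xAvg s K) (Finset.range K : Set ℕ) := fun _ _ hst =>
  congrArg ((K : ℝ)⁻¹ • ·) (dependsOn_sum_range (fun k => dependsOn_range_mono k.le_succ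
    (S.dependsOn_comp_iterate (fun z => S.xbarStep z.1 z.2) k)) K hst)

/-- The conditional mean of the dual increment. -/
noncomputable def Params.drift (S : Params n d)
    (z : EuclideanSpace ℝ (Fin d) × EuclideanSpace ℝ (Fin n)) : EuclideanSpace ℝ (Fin n) :=
  ∑ i, S.p i • ((S.step i z).2 - z.2)

/-- The martingale part of the dual iterates. -/
noncomputable def Params.noise (S : Params n d) (s : ℕ → Fin n) (k : ℕ) :
    EuclideanSpace ℝ (Fin n) :=
  ∑ j ∈ Finset.range k, ((S.iterate s (j + 1)).2 - (S.iterate s j).2 - S.drift (S.iterate s j))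

theorem Params.dependsOn_noise (S : Params n d) (k : ℕ) :
    DependsOn (fun s => S.noise s k) (Finset.range k : Set ℕ) := by
  refine dependsOn_sum_range (fun j s t hst => ?_) k
  rw [show S.iterate s (j + 1) = S.iterate t (j + 1) from S.dependsOn_iterate (j + 1) hst,
    show S.iterate s j = S.iterate t j from
      dependsOn_range_mono j.le_succ (S.dependsOn_iterate j) hst]

theorem Params.noise_update_succ (S : Params n d) (s : ℕ → Fin n) (k : ℕ) (i : Fin n) :
    S.noise (Function.update s k i) (k + 1) = S.noise s k +
      ((S.step i (S.iterate s k)).2 - (S.iterate s k).2 - S.drift (S.iterate s k)) := by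
  have h : S.noise (Function.update s k i) k = S.noise s k :=
    update_of_dependsOn (S.dependsOn_noise k) s i
  rw [← h]
  conv_lhs => rw [Params.noise, Finset.sum_range_succ, S.iterate_update_succ, S.iterate_update]
  rfl

/-- The martingale part of `U` along the run. -/
noncomputable def Params.mart (S : Params n d)
    (U : EuclideanSpace ℝ (Fin d) × EuclideanSpace ℝ (Fin n) → ℝ) (s : ℕ → Fin n) (k : ℕ) : ℝ :=
  ∑ j ∈ Finset.range k, ∑ i, S.p i * (U (S.iterate s j) - U (S.step i (S.iterate s j)))
    + U (S.iterate s k)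

theorem Params.dependsOn_mart (S : Params n d)
    (U : EuclideanSpace ℝ (Fin d) × EuclideanSpace ℝ (Fin n) → ℝ) (k : ℕ) :
    DependsOn (fun s => S.mart U s k) (Finset.range k : Set ℕ) := fun _ _ hst =>
  congrArg₂ (· + ·) (dependsOn_sum_range (fun j => dependsOn_range_mono j.le_succ
    (S.dependsOn_comp_iterate (fun z => ∑ i, S.p i * (U z - U (S.step i z))) j)) k hst)
    (S.dependsOn_comp_iterate U k hst)

/-- The sum in `mart` restores the expected drop of `U`, so what remains is an exact martingale,
whatever `U` is. -/
theorem Params.sum_mart_update (S : Params n d) (hp : ∑ i, S.p i = 1)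
    (U : EuclideanSpace ℝ (Fin d) × EuclideanSpace ℝ (Fin n) → ℝ) (s : ℕ → Fin n) (k : ℕ) :
    ∑ i, S.p i * S.mart U (Function.update s k i) (k + 1) = S.mart U s k := by
  have h : ∀ i, S.mart U (Function.update s k i) (k + 1) = S.mart U s k - U (S.iterate s k)
      + ∑ i, S.p i * (U (S.iterate s k) - U (S.step i (S.iterate s k)))
      + U (S.step i (S.iterate s k)) := by
    intro i
    have h1 : S.mart U (Function.update s k i) k = S.mart U s k :=
      update_of_dependsOn (S.dependsOn_mart U k) s i
    rw [← h1]
    simp only [Params.mart, Finset.sum_range_succ, S.iterate_update_succ, S.iterate_update]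
    ring
  simp only [h, mul_add, Finset.sum_add_distrib, mul_sub, Finset.sum_sub_distrib]
  simp only [← Finset.sum_mul, hp]
  ring

variable {A : Matrix (Fin n) (Fin d) ℝ} {g : EuclideanSpace ℝ (Fin d) → EReal}
  {hs : Fin n → ℝ → EReal} {γ R : ℝ} {x₀ : EuclideanSpace ℝ (Fin d)}
  {y₀ : EuclideanSpace ℝ (Fin n)} {xs : EuclideanSpace ℝ (Fin d)} {ys : EuclideanSpace ℝ (Fin n)}
  {Ω : Type*} [MeasurableSpace Ω] {P : Measure Ω} {I : ℕ → Ω → Fin n}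

theorem Admissible.xbarStep_ne_top (hS : Admissible A g hs γ R)
    (x : EuclideanSpace ℝ (Fin d)) (y : EuclideanSpace ℝ (Fin n)) :
    g ((importanceParams A g hs γ x₀ y₀).xbarStep x y) ≠ ⊤ := by
  refine hS.primal.prox_ne_top ?_ _
  simp only [importanceParams, hS.sum_eq]
  exact one_div_pos.2 hS.sum_pos

theorem Admissible.lyapunov_saddle (hS : Admissible A g hs γ R) (hsol : IsSaddle A g hs xs ys)
    (z : EuclideanSpace ℝ (Fin d) × EuclideanSpace ℝ (Fin n)) :
    ∑ i, (importanceParams A g hs γ x₀ y₀).p i *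
      (lyapunov γ R xs ys ((importanceParams A g hs γ x₀ y₀).step i z) +
        (1 - γ) * (R / (2 * γ)) * ‖((importanceParams A g hs γ x₀ y₀).step i z).2 - z.2‖ ^ 2)
      ≤ lyapunov γ R xs ys z := by
  have h := hS.one_step (x₀ := x₀) (y₀ := y₀) (hsol.primal_ne_top hS.primal hS.dual)
    (fun y hy => hsol.dual_le hS.primal hS.dual hy) (hsol.dual_ne_top hS.primal hS.dual) z
  have h2 := hsol.primal_le hS.primal hS.dual
    (hS.xbarStep_ne_top (x₀ := x₀) (y₀ := y₀) z.1 z.2)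
  simp only [sub_sub, mul_sub _ (lyapunov γ R xs ys z), Finset.sum_sub_distrib] at h
  rw [← Finset.sum_mul, hS.sum_p, one_mul] at h
  linarith

/-- The surplus `(1 - γ) * (R / (2 * γ)) * ‖Δy‖²` in the saddle point descent pays for the growth of
`κ * ‖noise‖²`, so the sum of both is a supermartingale and its expectation never exceeds its
initial value. -/
theorem Admissible.integral_noise_sq_le [IsProbabilityMeasure P] (hS : Admissible A g hs γ R)
    (hI : ∀ k, Measurable (I k)) (hindep : iIndepFun I P)
    (hlaw : ∀ k i, P.real {ω | I k ω = i} = (importanceParams A g hs γ x₀ y₀).p i)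
    (hsol : IsSaddle A g hs xs ys) (K : ℕ) :
    (1 - γ) * ∫ ω, ‖(importanceParams A g hs γ x₀ y₀).noise (fun j => I j ω) K‖ ^ 2 ∂P
      ≤ γ * ‖xs - x₀‖ ^ 2 + ‖ys - y₀‖ ^ 2 := by
  have hR := hS.sum_pos
  have hγ := hS.γ_pos
  have hγ1 := hS.γ_lt
  have hnn : ∀ i, 0 ≤ (importanceParams A g hs γ x₀ y₀).p i := fun i => hS.p_nonneg i
  have hsum : ∑ i, (importanceParams A g hs γ x₀ y₀).p i = 1 := hS.sum_p
  have hly := hS.lyapunov_saddle (x₀ := x₀) (y₀ := y₀) hsol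
  have hinit : ∀ s, (importanceParams A g hs γ x₀ y₀).iterate s 0 = (x₀, y₀) := fun _ => rfl
  set S := importanceParams A g hs γ x₀ y₀
  set κ := (1 - γ) * (R / (2 * γ)) with hκ
  have hκ0 : 0 ≤ κ := mul_nonneg (by linarith) (by positivity)
  have hdep : ∀ k, DependsOn (fun s => lyapunov γ R xs ys (S.iterate s k)
      + κ * ‖S.noise s k‖ ^ 2) (Finset.range k : Set ℕ) := fun k _ _ hst =>
    congrArg₂ (· + ·) (S.dependsOn_comp_iterate _ k hst)
      (congrArg (fun u => κ * ‖u‖ ^ 2) (S.dependsOn_noise k hst))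
  have h := integral_path_le_of_supermartingale hI hindep hlaw hdep (c := lyapunov γ R xs ys (x₀, y₀))
    (fun k s => by
      simp only [S.iterate_update_succ, S.noise_update_succ]
      have h1 := hly (S.iterate s k)
      have h2 := sum_mul_norm_add_sub_mean_sq_le hsum (S.noise s k)
        fun i => (S.step i (S.iterate s k)).2 - (S.iterate s k).2
      change ∑ i, S.p i * ‖S.noise s k + ((S.step i (S.iterate s k)).2 - (S.iterate s k).2
        - S.drift (S.iterate s k))‖ ^ 2 ≤ _ at h2
      have h3 := mul_le_mul_of_nonneg_left h2 hκ0
      simp only [mul_add, Finset.sum_add_distrib, Finset.mul_sum, mul_left_comm _ κ] at h1 h3 ⊢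
      linarith)
    (fun s => by simp [hinit, Params.noise]) K
  have hle : ∫ ω, κ * ‖S.noise (fun j => I j ω) K‖ ^ 2 ∂P ≤ lyapunov γ R xs ys (x₀, y₀) := by
    refine le_trans (integral_mono ?_ (integrable_path hI (hdep K)) fun ω => ?_) h
    · exact integrable_path (F := fun s => κ * ‖S.noise s K‖ ^ 2) hI fun _ _ hst =>
        congrArg (fun u => κ * ‖u‖ ^ 2) (S.dependsOn_noise K hst)
    · have : 0 ≤ lyapunov γ R xs ys (S.iterate (fun j => I j ω) K) := by
        unfold lyapunov; positivity
      simpa using this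
  rw [integral_const_mul, lyapunov, norm_sub_rev x₀, norm_sub_rev y₀] at hle
  have hc : 0 < 2 * γ / R := by positivity
  have h4 := mul_le_mul_of_nonneg_left hle hc.le
  have e1 : ∀ t, 2 * γ / R * (κ * t) = (1 - γ) * t := by intro t; rw [hκ]; field_simp
  have e2 : 2 * γ / R * (R / 2 * ‖xs - x₀‖ ^ 2 + R / (2 * γ) * ‖ys - y₀‖ ^ 2)
      = γ * ‖xs - x₀‖ ^ 2 + ‖ys - y₀‖ ^ 2 := by field_simp
  rwa [e1, e2] at h4

theorem Admissible.integral_noise_le [IsProbabilityMeasure P] (hS : Admissible A g hs γ R)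
    (hI : ∀ k, Measurable (I k)) (hindep : iIndepFun I P)
    (hlaw : ∀ k i, P.real {ω | I k ω = i} = (importanceParams A g hs γ x₀ y₀).p i)
    (hsol : IsSaddle A g hs xs ys) (K : ℕ) :
    ∫ ω, ‖(importanceParams A g hs γ x₀ y₀).noise (fun j => I j ω) K‖ ∂P
      ≤ (‖xs - x₀‖ + ‖ys - y₀‖) / (1 - γ) := by
  have hγ := hS.γ_pos
  have hγ1 : 0 < 1 - γ := sub_pos.2 hS.γ_lt
  have h := hS.integral_noise_sq_le hI hindep hlaw hsol K
  set S := importanceParams A g hs γ x₀ y₀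
  set X := ‖xs - x₀‖
  set Y := ‖ys - y₀‖
  have hX : 0 ≤ X := norm_nonneg _
  have hY : 0 ≤ Y := norm_nonneg _
  set e := ∫ ω, ‖S.noise (fun j => I j ω) K‖ ∂P with he
  have hi1 : Integrable (fun ω => ‖S.noise (fun j => I j ω) K‖) P :=
    integrable_path (F := fun s => ‖S.noise s K‖) hI fun _ _ hst =>
      congrArg norm (S.dependsOn_noise K hst)
  have hi2 : Integrable (fun ω => ‖S.noise (fun j => I j ω) K‖ ^ 2) P :=
    integrable_path (F := fun s => ‖S.noise s K‖ ^ 2) hI fun _ _ hst =>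
      congrArg (fun u => ‖u‖ ^ 2) (S.dependsOn_noise K hst)
  -- Nonnegativity of the variance, from integrating `2 e ‖N‖ - e² ≤ ‖N‖²`.
  have hvar : 2 * e * e - e ^ 2 ≤ ∫ ω, ‖S.noise (fun j => I j ω) K‖ ^ 2 ∂P := by
    have e1 : ∫ ω, (2 * e * ‖S.noise (fun j => I j ω) K‖ - e ^ 2) ∂P = 2 * e * e - e ^ 2 := by
      rw [integral_sub (hi1.const_mul _) (integrable_const _), integral_const_mul, ← he]
      simp
    rw [← e1]
    refine integral_mono ((hi1.const_mul _).sub (integrable_const _)) hi2 fun ω => ?_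
    simp only
    nlinarith [sq_nonneg (‖S.noise (fun j => I j ω) K‖ - e)]
  rw [le_div_iff₀ hγ1]
  have h0 : 0 ≤ e := integral_nonneg fun ω => norm_nonneg _
  refine abs_le_of_sq_le_sq' ?_ (by positivity) |>.2
  nlinarith [mul_le_mul_of_nonneg_left hvar hγ1.le, sq_nonneg e, mul_nonneg hX hY, sq_nonneg X,
    mul_nonneg hγ.le (mul_nonneg hγ1.le (sq_nonneg e)), mul_nonneg hγ1.le (sq_nonneg X)]

theorem Admissible.xAvg_convex (hS : Admissible A g hs γ R) (s : ℕ → Fin n) {K : ℕ}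
    (hK : 1 ≤ K) :
    g ((importanceParams A g hs γ x₀ y₀).xAvg s K) ≠ ⊤ ∧
    K * (g ((importanceParams A g hs γ x₀ y₀).xAvg s K)).toReal ≤
      ∑ k ∈ Finset.range K, (g ((importanceParams A g hs γ x₀ y₀).xbarSucc s k)).toReal := by
  have hK0 : (0 : ℝ) < K := by exact_mod_cast hK
  have hw : ∑ _k ∈ Finset.range K, (K : ℝ)⁻¹ = 1 := by
    simp [hK0.ne']
  have hmem : ∀ k ∈ Finset.range K, (importanceParams A g hs γ x₀ y₀).xbarSucc s k ∈
      {x | g x ≠ ⊤} := fun k _ => hS.xbarStep_ne_top _ _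
  have h1 := hS.primal.convexOn.1.sum_mem (fun _ _ => (inv_pos.2 hK0).le) hw hmem
  have h2 := hS.primal.convexOn.map_sum_le (fun _ _ => (inv_pos.2 hK0).le) hw hmem
  simp only [← Finset.smul_sum] at h1 h2
  refine ⟨h1, ?_⟩
  have h3 := mul_le_mul_of_nonneg_left h2 hK0.le
  rwa [smul_eq_mul, mul_inv_cancel_left₀ hK0.ne'] at h3

/-- The gap of the ergodic average, along a single run and uniformly in the dual point. -/
theorem Admissible.pathwise_gap (hS : Admissible A g hs γ R) (s : ℕ → Fin n) {K : ℕ}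
    (hK : 1 ≤ K) {x : EuclideanSpace ℝ (Fin d)} (hx : g x ≠ ⊤) {c : ℝ}
    (hc : ∀ y, separable hs y ≠ ⊤ → inner ℝ (app A x) y - (separable hs y).toReal ≤ c)
    {v : EuclideanSpace ℝ (Fin n)} (hv : separable hs v ≠ ⊤) :
    K * ((g ((importanceParams A g hs γ x₀ y₀).xAvg s K)).toReal - (g x).toReal - c
      + inner ℝ (app A ((importanceParams A g hs γ x₀ y₀).xAvg s K)) v
      - (separable hs v).toReal)
    ≤ (importanceParams A g hs γ x₀ y₀).mart (lyapunov γ R x 0) s K - R / (2 * γ) * ‖y₀‖ ^ 2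
      + R / (2 * γ) * (‖v - y₀‖ ^ 2
        + 2 * (‖v‖ * ‖(importanceParams A g hs γ x₀ y₀).noise s K‖)) := by
  have hR := hS.sum_pos
  have hγ := hS.γ_pos
  have hγ1 := hS.γ_lt
  have hK0 : (0 : ℝ) < K := by exact_mod_cast hK
  have hconv := (hS.xAvg_convex (x₀ := x₀) (y₀ := y₀) s hK).2
  have hstep := hS.one_step (x₀ := x₀) (y₀ := y₀) hx hc hv
  have hnn : ∀ i, 0 ≤ (importanceParams A g hs γ x₀ y₀).p i := fun i => hS.p_nonneg i
  have hinit : ((importanceParams A g hs γ x₀ y₀).iterate s 0).2 = y₀ := rfl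
  have hAvg : (K : ℝ) * inner ℝ (app A ((importanceParams A g hs γ x₀ y₀).xAvg s K)) v
      = ∑ k ∈ Finset.range K,
        inner ℝ (app A ((importanceParams A g hs γ x₀ y₀).xbarSucc s k)) v := by
    rw [Params.xAvg, app_smul, inner_smul_left, app_sum, sum_inner]
    simp [hK0.ne']
  set S := importanceParams A g hs γ x₀ y₀
  have hk : ∀ k ∈ Finset.range K, (g (S.xbarSucc s k)).toReal - (g x).toReal - c
      + inner ℝ (app A (S.xbarSucc s k)) v - (separable hs v).toReal
      ≤ ∑ i, S.p i * (lyapunov γ R x 0 (S.iterate s k)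
          - lyapunov γ R x 0 (S.step i (S.iterate s k)))
        + R / γ * inner ℝ (S.drift (S.iterate s k)) v := by
    intro k _
    refine (hstep (S.iterate s k)).trans ?_
    rw [Params.drift, sum_inner, Finset.mul_sum, ← Finset.sum_add_distrib]
    refine Finset.sum_le_sum fun i _ => ?_
    rw [lyapunov_sub_eq, inner_smul_left]
    have h1 : 0 ≤ (1 - γ) * (R / (2 * γ)) * ‖(S.step i (S.iterate s k)).2 - (S.iterate s k).2‖ ^ 2 :=
      mul_nonneg (mul_nonneg (by linarith) (by positivity)) (sq_nonneg _)
    have h2 := mul_nonneg (hnn i) h1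
    simp only [conj_trivial]
    linarith
  have hsum := Finset.sum_le_sum hk
  have hdrift : ∑ k ∈ Finset.range K, S.drift (S.iterate s k)
      = (S.iterate s K).2 - y₀ - S.noise s K := by
    rw [Params.noise, Finset.sum_sub_distrib,
      Finset.sum_range_sub fun k => (S.iterate s k).2, hinit]
    abel
  rw [Finset.sum_add_distrib, ← Finset.mul_sum, ← sum_inner, hdrift] at hsum
  simp only [Finset.sum_add_distrib, Finset.sum_sub_distrib, Finset.sum_const, Finset.card_range,
    nsmul_eq_mul] at hsum
  have hM : ∑ k ∈ Finset.range K, ∑ i, S.p i * (lyapunov γ R x 0 (S.iterate s k)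
      - lyapunov γ R x 0 (S.step i (S.iterate s k)))
      = S.mart (lyapunov γ R x 0) s K - lyapunov γ R x 0 (S.iterate s K) := by
    rw [Params.mart]; ring
  have hU : R / (2 * γ) * ‖(S.iterate s K).2‖ ^ 2 ≤ lyapunov γ R x 0 (S.iterate s K) := by
    rw [lyapunov, sub_zero]
    have : 0 ≤ R / 2 * ‖(S.iterate s K).1 - x‖ ^ 2 := by positivity
    linarith
  -- Completing the square: `2⟨y_K, v⟩ ≤ ‖y_K‖² + ‖v‖²`, and the resulting `‖y_K‖²` is absorbed by
  -- the terminal Lyapunov value in `hU`.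
  have hin : R / γ * inner ℝ ((S.iterate s K).2 - y₀ - S.noise s K) v
      ≤ R / (2 * γ) * (‖(S.iterate s K).2‖ ^ 2 - ‖y₀‖ ^ 2 + ‖v - y₀‖ ^ 2
        + 2 * (‖v‖ * ‖S.noise s K‖)) := by
    have e : R / γ * inner ℝ ((S.iterate s K).2 - y₀ - S.noise s K) v
        = R / (2 * γ) * (2 * inner ℝ ((S.iterate s K).2 - y₀ - S.noise s K) v) := by
      field_simp
    rw [e]
    refine mul_le_mul_of_nonneg_left ?_ (by positivity)
    have h1 := norm_sub_sq_real (S.iterate s K).2 v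
    have h2 := norm_sub_sq_real v y₀
    have h3 := real_inner_le_norm (-S.noise s K) v
    rw [inner_neg_left, norm_neg] at h3
    rw [inner_sub_left, inner_sub_left]
    rw [real_inner_comm] at h2
    nlinarith [sq_nonneg ‖(S.iterate s K).2 - v‖]
  rw [hM] at hsum
  have e : (K : ℝ) * ((g (S.xAvg s K)).toReal - (g x).toReal - c
      + inner ℝ (app A (S.xAvg s K)) v - (separable hs v).toReal)
      = K * (g (S.xAvg s K)).toReal - K * (g x).toReal - K * c
      + K * inner ℝ (app A (S.xAvg s K)) v - K * (separable hs v).toReal := by ring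
  rw [e, hAvg]
  linarith

/-- The expected gap, for a dual point that may depend on the run. -/
theorem Admissible.expected_gap [IsProbabilityMeasure P] (hS : Admissible A g hs γ R)
    (hI : ∀ k, Measurable (I k)) (hindep : iIndepFun I P)
    (hlaw : ∀ k i, P.real {ω | I k ω = i} = (importanceParams A g hs γ x₀ y₀).p i)
    (hsol : IsSaddle A g hs xs ys) {K : ℕ} (hK : 1 ≤ K)
    {x : EuclideanSpace ℝ (Fin d)} (hx : g x ≠ ⊤) {c : ℝ}
    (hc : ∀ y, separable hs y ≠ ⊤ → inner ℝ (app A x) y - (separable hs y).toReal ≤ c)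
    {ρ ρ' : ℝ} (hρ : 0 ≤ ρ) {T : EuclideanSpace ℝ (Fin d) → ℝ}
    (hT : ∀ u B, g u ≠ ⊤ → (∀ v, separable hs v ≠ ⊤ → ‖v‖ ≤ ρ → ‖v - y₀‖ ≤ ρ' →
      (g u).toReal - (g x).toReal - c + inner ℝ (app A u) v - (separable hs v).toReal ≤ B) →
      T u ≤ B) :
    ∫ ω, T ((importanceParams A g hs γ x₀ y₀).xAvg (fun j => I j ω) K) ∂P
      ≤ R / (2 * γ * K) * (γ * ‖x - x₀‖ ^ 2 + ρ' ^ 2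
        + 2 * ρ * ((‖xs - x₀‖ + ‖ys - y₀‖) / (1 - γ))) := by
  have hR := hS.sum_pos
  have hγ := hS.γ_pos
  have hK0 : (0 : ℝ) < K := by exact_mod_cast hK
  have hnoise := hS.integral_noise_le hI hindep hlaw hsol K
  have hgap := fun s v hv => hS.pathwise_gap (x₀ := x₀) (y₀ := y₀) s hK hx hc (v := v) hv
  have hfin := fun s => (hS.xAvg_convex (x₀ := x₀) (y₀ := y₀) s hK).1
  have hsum : ∑ i, (importanceParams A g hs γ x₀ y₀).p i = 1 := hS.sum_p
  have hinit : ∀ s, (importanceParams A g hs γ x₀ y₀).iterate s 0 = (x₀, y₀) := fun _ => rfl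
  set S := importanceParams A g hs γ x₀ y₀
  set m := (‖xs - x₀‖ + ‖ys - y₀‖) / (1 - γ)
  have hmart : ∫ ω, S.mart (lyapunov γ R x 0) (fun j => I j ω) K ∂P
      ≤ R / 2 * ‖x₀ - x‖ ^ 2 + R / (2 * γ) * ‖y₀‖ ^ 2 :=
    integral_path_le_of_supermartingale hI hindep hlaw (F := fun k s => S.mart _ s k)
      (S.dependsOn_mart _) (fun k s => (S.sum_mart_update hsum _ s k).le)
      (fun s => by simp [Params.mart, hinit, lyapunov]) K
  have hi1 : Integrable (fun ω => S.mart (lyapunov γ R x 0) (fun j => I j ω) K) P :=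
    integrable_path hI (S.dependsOn_mart _ K)
  have hi2 : Integrable (fun ω => ‖S.noise (fun j => I j ω) K‖) P :=
    integrable_path (F := fun s => ‖S.noise s K‖) hI fun _ _ hst =>
      congrArg norm (S.dependsOn_noise K hst)
  have hi3 : Integrable (fun ω => T (S.xAvg (fun j => I j ω) K)) P :=
    integrable_path (F := fun s => T (S.xAvg s K)) hI fun _ _ hst =>
      congrArg T (S.dependsOn_xAvg K hst)
  -- For fixed ω the right side bounds the gap for every admissible `v`, so `hT` passes to `T`
  -- without any measurable selection of a maximizing `v`.
  have hpt : ∀ ω, T (S.xAvg (fun j => I j ω) K) ≤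
      (K : ℝ)⁻¹ * (S.mart (lyapunov γ R x 0) (fun j => I j ω) K
        + (R / (2 * γ) * (2 * ρ) * ‖S.noise (fun j => I j ω) K‖
          + R / (2 * γ) * (ρ' ^ 2 - ‖y₀‖ ^ 2))) := by
    intro ω
    refine hT _ _ (hfin _) fun v hv h1 h2 => ?_
    rw [inv_mul_eq_div, le_div_iff₀' hK0]
    refine (hgap _ v hv).trans ?_
    have h3 : ‖v - y₀‖ ^ 2 ≤ ρ' ^ 2 := pow_le_pow_left₀ (norm_nonneg _) h2 2
    have h4 : ‖v‖ * ‖S.noise (fun j => I j ω) K‖ ≤ ρ * ‖S.noise (fun j => I j ω) K‖ :=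
      mul_le_mul_of_nonneg_right h1 (norm_nonneg _)
    have h5 : R / (2 * γ) * (‖v - y₀‖ ^ 2 + 2 * (‖v‖ * ‖S.noise (fun j => I j ω) K‖))
        ≤ R / (2 * γ) * (ρ' ^ 2 + 2 * (ρ * ‖S.noise (fun j => I j ω) K‖)) := by gcongr
    linarith
  have hi4 := hi2.const_mul (R / (2 * γ) * (2 * ρ))
  have hi5 : Integrable (fun ω => R / (2 * γ) * (2 * ρ) * ‖S.noise (fun j => I j ω) K‖
      + R / (2 * γ) * (ρ' ^ 2 - ‖y₀‖ ^ 2)) P := hi4.add (integrable_const _)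
  have h := integral_mono hi3 ((hi1.add hi5).const_mul (K : ℝ)⁻¹) hpt
  simp only [Pi.add_apply] at h
  rw [integral_const_mul, integral_add hi1 hi5, integral_add hi4 (integrable_const _), integral_const_mul] at h
  simp only [integral_const, probReal_univ, one_smul] at h
  refine h.trans ?_
  have h6 : R / (2 * γ) * (2 * ρ) * ∫ ω, ‖S.noise (fun j => I j ω) K‖ ∂P
      ≤ R / (2 * γ) * (2 * ρ) * m := mul_le_mul_of_nonneg_left hnoise (by positivity)
  have e : R / (2 * γ * K) * (γ * ‖x - x₀‖ ^ 2 + ρ' ^ 2 + 2 * ρ * m)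
      = (K : ℝ)⁻¹ * (R / 2 * ‖x₀ - x‖ ^ 2 + R / (2 * γ) * ‖y₀‖ ^ 2
        + (R / (2 * γ) * (2 * ρ) * m + R / (2 * γ) * (ρ' ^ 2 - ‖y₀‖ ^ 2))) := by
    rw [norm_sub_rev x₀ x]; field_simp; ring
  rw [e]
  refine mul_le_mul_of_nonneg_left ?_ (inv_pos.2 hK0).le
  linarith

end Run


/-! ### Duality for indicator functions and for Lipschitz functions -/

section Indicator

variable {n d : ℕ} {A : Matrix (Fin n) (Fin d) ℝ} {g : EuclideanSpace ℝ (Fin d) → EReal}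
  {hs : Fin n → ℝ → EReal} {xs : EuclideanSpace ℝ (Fin d)} {ys : EuclideanSpace ℝ (Fin n)}
  {C : Set (EuclideanSpace ℝ (Fin n))}

theorem mem_of_indicator_ne_top {z : EuclideanSpace ℝ (Fin n)} (h : indicator C z ≠ ⊤) : z ∈ C := by
  by_contra hz
  exact h (if_neg hz)

theorem indicator_of_mem {z : EuclideanSpace ℝ (Fin n)} (h : z ∈ C) : indicator C z = 0 :=
  if_pos h

theorem inner_le_of_mem (hh : ProperConvexLsc (separable hs))
    (hind : separable (fun i => conj (hs i)) = indicator C) {z : EuclideanSpace ℝ (Fin n)}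
    (hz : z ∈ C) {y : EuclideanSpace ℝ (Fin n)} (hy : separable hs y ≠ ⊤) :
    inner ℝ z y - (separable hs y).toReal ≤ 0 := by
  have h := inner_sub_le_separable_conj hh z hy
  rwa [hind, indicator_of_mem hz, ← EReal.coe_zero, EReal.coe_le_coe_iff] at h

theorem IsSaddle.app_mem (hg : ProperConvexLsc g) (hh : ProperConvexLsc (separable hs))
    (hsol : IsSaddle A g hs xs ys) (hind : separable (fun i => conj (hs i)) = indicator C) :
    app A xs ∈ C ∧ inner ℝ (app A xs) ys = (separable hs ys).toReal := by
  have h := hsol.separable_conj_eq hg hh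
  rw [hind] at h
  have hmem : app A xs ∈ C := mem_of_indicator_ne_top (by rw [h]; exact EReal.coe_ne_top _)
  rw [indicator_of_mem hmem, ← EReal.coe_zero, EReal.coe_eq_coe_iff] at h
  exact ⟨hmem, by linarith⟩

theorem exists_proj (hne : C.Nonempty) (hconv : Convex ℝ C) (hcl : IsClosed C)
    (z : EuclideanSpace ℝ (Fin n)) : ∃ w ∈ C, ‖z - w‖ = Metric.infDist z C ∧
      ∀ w' ∈ C, inner ℝ (z - w) (w' - w) ≤ 0 := by
  obtain ⟨w, hw, h⟩ := exists_norm_eq_iInf_of_complete_convex hne hcl.isComplete hconv z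
  refine ⟨w, hw, ?_, (norm_eq_iInf_iff_real_inner_le_zero hconv hw).1 h⟩
  rw [h, Metric.infDist_eq_iInf]
  simp only [dist_eq_norm]

/-- Take `v` of length `r` along `z - w`, where `w` is the projection of `z` onto `C`. The support
function of `C` at `v` is attained at `w`, so `h* v ≤ ⟨w, v⟩`. If `z = w`, the convention `0⁻¹ = 0`
makes `v = 0`. -/
theorem exists_dual_infDist (hh : ProperConvexLsc (separable hs)) (hne : C.Nonempty)
    (hconv : Convex ℝ C) (hcl : IsClosed C)
    (hind : separable (fun i => conj (hs i)) = indicator C) (z : EuclideanSpace ℝ (Fin n)) {r : ℝ}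
    (hr : 0 ≤ r) : ∃ v, separable hs v ≠ ⊤ ∧ ‖v‖ ≤ r ∧
      r * Metric.infDist z C ≤ inner ℝ z v - (separable hs v).toReal := by
  obtain ⟨w, hw, hdist, hproj⟩ := exists_proj hne hconv hcl z
  rw [← hdist]
  have hκ : 0 ≤ r * ‖z - w‖⁻¹ := mul_nonneg hr (inv_nonneg.2 (norm_nonneg _))
  have hsupp := separable_le_support hh hne hind (v := (r * ‖z - w‖⁻¹) • (z - w))
    (c := inner ℝ w ((r * ‖z - w‖⁻¹) • (z - w))) fun w' hw' => by
      rw [inner_smul_right, inner_smul_right]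
      refine mul_le_mul_of_nonneg_left ?_ hκ
      have := hproj w' hw'
      rw [inner_sub_right, real_inner_comm, real_inner_comm w] at this
      linarith
  obtain ⟨hdom, hle⟩ := hh.le_coe_iff.1 hsupp
  refine ⟨_, hdom, ?_, ?_⟩
  · rw [norm_smul, Real.norm_of_nonneg hκ, mul_assoc]
    refine mul_le_of_le_one_right hr ?_
    by_cases h0 : ‖z - w‖ = 0
    · simp [h0]
    · rw [inv_mul_cancel₀ h0]
  · have e : inner ℝ z ((r * ‖z - w‖⁻¹) • (z - w)) - inner ℝ w ((r * ‖z - w‖⁻¹) • (z - w))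
        = r * ‖z - w‖ := by
      rw [← inner_sub_left, inner_smul_right, real_inner_self_eq_norm_sq]
      by_cases h0 : ‖z - w‖ = 0
      · simp [h0]
      · field_simp
    linarith

/-- The projection `w` of `A x` onto `C` satisfies `⟨w, ys⟩ ≤ h* ys = ⟨A xs, ys⟩`. The saddle
inequality and Cauchy-Schwarz for `A x - w` do the rest. -/
theorem IsSaddle.neg_mul_infDist_le (hg : ProperConvexLsc g) (hh : ProperConvexLsc (separable hs))
    (hsol : IsSaddle A g hs xs ys) (hne : C.Nonempty) (hconv : Convex ℝ C) (hcl : IsClosed C)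
    (hind : separable (fun i => conj (hs i)) = indicator C) {x : EuclideanSpace ℝ (Fin d)}
    (hx : g x ≠ ⊤) :
    -(‖ys‖ * Metric.infDist (app A x) C) ≤ (g x).toReal - (g xs).toReal := by
  obtain ⟨w, hw, hdist, -⟩ := exists_proj hne hconv hcl (app A x)
  rw [← hdist]
  have h1 := hsol.primal_le hg hh hx
  have h2 := (hsol.app_mem hg hh hind).2
  have h3 := inner_le_of_mem hh hind hw (hsol.dual_ne_top hg hh)
  have h4 := real_inner_le_norm (app A x - w) ys
  rw [inner_sub_left] at h4
  linarith

theorem IsSaddle.primal_value_le (hg : ProperConvexLsc g) (hh : ProperConvexLsc (separable hs))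
    (hsol : IsSaddle A g hs xs ys) (hind : separable (fun i => conj (hs i)) = indicator C)
    {x : EuclideanSpace ℝ (Fin d)} (hx : g x ≠ ⊤) (hmem : app A x ∈ C) :
    (g xs).toReal ≤ (g x).toReal := by
  have h1 := hsol.primal_le hg hh hx
  have h2 := (hsol.app_mem hg hh hind).2
  have h3 := inner_le_of_mem hh hind hmem (hsol.dual_ne_top hg hh)
  linarith

/-- The domain of `h*` is bounded by the Lipschitz constant of `h`. -/
theorem norm_le_of_lipschitz (hh : ProperConvexLsc (separable hs)) {L : ℝ≥0}
    (hL : IsLipschitzReal L (separable fun i => conj (hs i))) {y : EuclideanSpace ℝ (Fin n)}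
    (hy : separable hs y ≠ ⊤) : ‖y‖ ≤ L := by
  obtain ⟨f, hf, hlip⟩ := hL
  by_contra hcon
  rw [not_le] at hcon
  set c := f 0 + (separable hs y).toReal with hc
  -- Along `t • y`, Fenchel-Young makes `h` grow at rate at least `‖y‖²`, the Lipschitz bound at
  -- rate at most `L * ‖y‖`; large `t` contradicts `‖y‖ > L`.
  have key : ∀ t : ℝ, 0 ≤ t → t * (‖y‖ * (‖y‖ - L)) ≤ c := by
    intro t ht
    have h1 := inner_sub_le_separable_conj hh (t • y) hy
    rw [hf, EReal.coe_le_coe_iff, inner_smul_left, real_inner_self_eq_norm_sq] at h1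
    have h2 := hlip.dist_le_mul (t • y) 0
    rw [dist_zero_right, norm_smul, Real.norm_of_nonneg ht, Real.dist_eq] at h2
    have h3 := (abs_le.1 h2).2
    simp only [conj_trivial] at h1
    nlinarith
  have hpos : 0 < ‖y‖ * (‖y‖ - L) :=
    mul_pos (lt_of_le_of_lt L.coe_nonneg hcon) (sub_pos.2 hcon)
  have h := key ((|c| + 1) / (‖y‖ * (‖y‖ - L))) (by positivity)
  rw [div_mul_cancel₀ _ hpos.ne'] at h
  linarith [le_abs_self c]

end Indicator

/-! ### The three convergence rates -/

section Rates

variable {n d : ℕ} {A : Matrix (Fin n) (Fin d) ℝ} {g : EuclideanSpace ℝ (Fin d) → EReal}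
  {hs : Fin n → ℝ → EReal} {γ R : ℝ} {x₀ : EuclideanSpace ℝ (Fin d)}
  {y₀ : EuclideanSpace ℝ (Fin n)} {xs : EuclideanSpace ℝ (Fin d)} {ys : EuclideanSpace ℝ (Fin n)}
  {Ω : Type*} [MeasurableSpace Ω] {P : Measure Ω} {I : ℕ → Ω → Fin n}

theorem Admissible.lipschitz_rate [IsProbabilityMeasure P] (hS : Admissible A g hs γ R)
    (hI : ∀ k, Measurable (I k)) (hindep : iIndepFun I P)
    (hlaw : ∀ k i, P.real {ω | I k ω = i} = (importanceParams A g hs γ x₀ y₀).p i)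
    (hsol : IsSaddle A g hs xs ys) {K : ℕ} (hK : 1 ≤ K) (hy₀ : separable hs y₀ ≠ ⊤)
    {L : ℝ≥0} (hL : IsLipschitzReal L (separable fun i => conj (hs i)))
    {T : EuclideanSpace ℝ (Fin d) → ℝ}
    (hT : ∀ u, T u = (separable (fun i => conj (hs i)) (app A u)).toReal + (g u).toReal
        - (separable (fun i => conj (hs i)) (app A xs)).toReal - (g xs).toReal) :
    ∫ ω, T ((importanceParams A g hs γ x₀ y₀).xAvg (fun j => I j ω) K) ∂P
      ≤ 2 * R / (K * γ * (1 - γ)) * (4 * (L : ℝ) ^ 2 + ‖xs - x₀‖ ^ 2) := by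
  have hR := hS.sum_pos
  have hγ := hS.γ_pos
  have hγ1 : 0 < 1 - γ := sub_pos.2 hS.γ_lt
  have hK0 : (0 : ℝ) < K := by exact_mod_cast hK
  have hbound : ∀ {y}, separable hs y ≠ ⊤ → ‖y‖ ≤ L := norm_le_of_lipschitz hS.dual hL
  have hys := hsol.dual_ne_top hS.primal hS.dual
  have hval := hsol.separable_conj_eq hS.primal hS.dual
  have h := hS.expected_gap hI hindep hlaw hsol hK (hsol.primal_ne_top hS.primal hS.dual)
    -- The domain of `h*`, including `y₀`, lies in the ball of radius `L`, so these radii exclude no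
    -- dual point and the supremum over `v` is `h (A u)`.
    (fun y hy => hsol.dual_le hS.primal hS.dual hy) (ρ := L) (ρ' := 2 * L) L.coe_nonneg (T := T)
    (fun u B hu hB => by
      obtain ⟨f, hf, -⟩ := hL
      rw [hT, hval, EReal.toReal_coe]
      have h1 := separable_conj_le hS.dual (z := app A u) (B := B - (g u).toReal + (g xs).toReal
        + (inner ℝ (app A xs) ys - (separable hs ys).toReal)) fun y hy => by
          have := hB y hy (hbound hy)
            ((norm_sub_le _ _).trans (by linarith [hbound hy, hbound hy₀]))
          linarith
      rw [hf, EReal.coe_le_coe_iff] at h1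
      rw [hf, EReal.toReal_coe]
      linarith)
  refine h.trans ?_
  have hY : ‖ys - y₀‖ ≤ 2 * L := (norm_sub_le _ _).trans (by linarith [hbound hys, hbound hy₀])
  set X := ‖xs - x₀‖ with hX
  set Y := ‖ys - y₀‖
  have hX0 : 0 ≤ X := norm_nonneg _
  have hL0 : (0 : ℝ) ≤ L := L.coe_nonneg
  have e : R / (2 * γ * K) * (γ * X ^ 2 + (2 * (L : ℝ)) ^ 2 + 2 * L * ((X + Y) / (1 - γ)))
      = R / (2 * γ * K * (1 - γ)) *
        ((1 - γ) * (γ * X ^ 2 + 4 * (L : ℝ) ^ 2) + 2 * L * (X + Y)) := by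
    field_simp; ring
  have e2 : 2 * R / (K * γ * (1 - γ)) * (4 * (L : ℝ) ^ 2 + X ^ 2)
      = R / (2 * γ * K * (1 - γ)) * (16 * (L : ℝ) ^ 2 + 4 * X ^ 2) := by
    field_simp; ring
  rw [e, e2]
  refine mul_le_mul_of_nonneg_left ?_ (by positivity)
  have h1 : (1 - γ) * (γ * X ^ 2 + 4 * (L : ℝ) ^ 2) ≤ X ^ 2 + 4 * (L : ℝ) ^ 2 := by
    nlinarith [sq_nonneg X, sq_nonneg (L : ℝ), hS.γ_lt, mul_nonneg hγ.le (sq_nonneg X),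
      mul_nonneg hγ.le (mul_nonneg hγ.le (sq_nonneg X)), mul_nonneg hγ1.le (sq_nonneg X),
      mul_nonneg hγ.le (sq_nonneg (L : ℝ))]
  nlinarith [sq_nonneg (X - L), mul_le_mul_of_nonneg_left hY hL0]

variable {C : Set (EuclideanSpace ℝ (Fin n))}

theorem Admissible.infDist_rate [IsProbabilityMeasure P] (hS : Admissible A g hs γ R)
    (hI : ∀ k, Measurable (I k)) (hindep : iIndepFun I P)
    (hlaw : ∀ k i, P.real {ω | I k ω = i} = (importanceParams A g hs γ x₀ y₀).p i)
    (hsol : IsSaddle A g hs xs ys) {K : ℕ} (hK : 1 ≤ K)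
    (hne : C.Nonempty) (hconv : Convex ℝ C) (hcl : IsClosed C)
    (hind : separable (fun i => conj (hs i)) = indicator C) :
    ∫ ω, Metric.infDist (app A ((importanceParams A g hs γ x₀ y₀).xAvg (fun j => I j ω) K)) C ∂P
      ≤ 8 * R / (K * γ * (1 - γ)) * (‖xs - x₀‖ + ‖ys - y₀‖ + ‖y₀‖ + ‖ys‖) := by
  have hR := hS.sum_pos
  have hγ := hS.γ_pos
  have hγ1 : 0 < 1 - γ := sub_pos.2 hS.γ_lt
  have hK0 : (0 : ℝ) < K := by exact_mod_cast hK
  have hmem := (hsol.app_mem hS.primal hS.dual hind).1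
  have hX0 : 0 ≤ ‖xs - x₀‖ := norm_nonneg _
  have hY0 : 0 ≤ ‖ys - y₀‖ := norm_nonneg _
  have ha0 : 0 ≤ ‖y₀‖ := norm_nonneg _
  have hb0 : 0 ≤ ‖ys‖ := norm_nonneg _
  -- With dual radius `‖ys‖ + s` the gap is at least `s * dist` and its bound is of order `s ^ 2`,
  -- so dividing by `s` leaves a linear bound. The sum of norms may vanish, hence a larger positive
  -- `s` and a final limit.
  have key : ∀ s : ℝ, 0 < s → ‖xs - x₀‖ + ‖ys - y₀‖ + ‖y₀‖ + ‖ys‖ ≤ s →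
      ∫ ω, Metric.infDist (app A ((importanceParams A g hs γ x₀ y₀).xAvg (fun j => I j ω) K)) C ∂P
      ≤ 8 * R / (K * γ * (1 - γ)) * s := by
    intro s hs0 hs1
    have h := hS.expected_gap hI hindep hlaw hsol hK (hsol.primal_ne_top hS.primal hS.dual)
      (c := 0) (fun y hy => inner_le_of_mem hS.dual hind hmem hy) (ρ := ‖ys‖ + s)
      (ρ' := ‖ys‖ + s + ‖y₀‖) (by positivity) (T := fun u => s * Metric.infDist (app A u) C)
      (fun u B hu hB => by
        obtain ⟨v, hv, hvr, hvd⟩ := exists_dual_infDist hS.dual hne hconv hcl hind (app A u)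
          (r := ‖ys‖ + s) (by positivity)
        have h1 := hB v hv hvr ((norm_sub_le _ _).trans (by linarith))
        have h2 := hsol.neg_mul_infDist_le hS.primal hS.dual hne hconv hcl hind hu
        linarith)
    rw [integral_const_mul] at h
    refine le_of_mul_le_mul_left (h.trans ?_) hs0
    set X := ‖xs - x₀‖
    set Y := ‖ys - y₀‖
    set a := ‖y₀‖
    set b := ‖ys‖
    have e : R / (2 * γ * K) * (γ * X ^ 2 + (b + s + a) ^ 2 + 2 * (b + s) * ((X + Y) / (1 - γ)))
        = R / (2 * γ * K * (1 - γ)) *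
          ((1 - γ) * (γ * X ^ 2 + (b + s + a) ^ 2) + 2 * ((b + s) * (X + Y))) := by
      field_simp
    have e2 : s * (8 * R / (K * γ * (1 - γ)) * s) = R / (2 * γ * K * (1 - γ)) * (16 * s ^ 2) := by
      field_simp; ring
    rw [e, e2]
    refine mul_le_mul_of_nonneg_left ?_ (by positivity)
    have h1 : X ^ 2 ≤ s ^ 2 := pow_le_pow_left₀ hX0 (by linarith) 2
    have h2 : (b + s + a) ^ 2 ≤ (2 * s) ^ 2 := pow_le_pow_left₀ (by positivity) (by linarith) 2
    have h3 : (b + s) * (X + Y) ≤ (2 * s) * s :=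
      mul_le_mul (by linarith) (by linarith) (by positivity) (by positivity)
    have h4 : γ * X ^ 2 ≤ X ^ 2 := mul_le_of_le_one_left (sq_nonneg _) hS.γ_lt.le
    have h5 : (1 - γ) * (γ * X ^ 2 + (b + s + a) ^ 2) ≤ γ * X ^ 2 + (b + s + a) ^ 2 :=
      mul_le_of_le_one_left (by positivity) (by linarith)
    nlinarith
  refine le_of_forall_pos_le_add fun ε hε => ?_
  have hQ : 0 ≤ 8 * R / (K * γ * (1 - γ)) := by positivity
  set Q := 8 * R / (K * γ * (1 - γ))
  have hδ : 0 < ε / (Q + 1) := by positivity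
  refine (key (‖xs - x₀‖ + ‖ys - y₀‖ + ‖y₀‖ + ‖ys‖ + ε / (Q + 1)) (by positivity)
    (by linarith)).trans ?_
  have : Q * (ε / (Q + 1)) ≤ ε := by
    rw [mul_div_assoc', div_le_iff₀ (by positivity)]; nlinarith
  linarith

theorem Admissible.value_rate [IsProbabilityMeasure P] (hS : Admissible A g hs γ R)
    (hI : ∀ k, Measurable (I k)) (hindep : iIndepFun I P)
    (hlaw : ∀ k i, P.real {ω | I k ω = i} = (importanceParams A g hs γ x₀ y₀).p i)
    (hsol : IsSaddle A g hs xs ys) {K : ℕ} (hK : 1 ≤ K)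
    (hne : C.Nonempty) (hconv : Convex ℝ C) (hcl : IsClosed C)
    (hind : separable (fun i => conj (hs i)) = indicator C) :
    ∫ ω, |(g ((importanceParams A g hs γ x₀ y₀).xAvg (fun j => I j ω) K)).toReal
        - (g xs).toReal| ∂P
      ≤ 8 * R / (K * γ * (1 - γ)) * ((‖xs - x₀‖ + ‖ys - y₀‖ + ‖y₀‖ + ‖ys‖) * ‖ys‖
        + distSol A g hs x₀ y₀ + ‖y₀‖ ^ 2) := by
  have hR := hS.sum_pos
  have hγ := hS.γ_pos
  have hγ1 : 0 < 1 - γ := sub_pos.2 hS.γ_lt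
  have hK0 : (0 : ℝ) < K := by exact_mod_cast hK
  have hX0 : 0 ≤ ‖xs - x₀‖ := norm_nonneg _
  have hY0 : 0 ≤ ‖ys - y₀‖ := norm_nonneg _
  have ha0 : 0 ≤ ‖y₀‖ := norm_nonneg _
  have hb0 : 0 ≤ ‖ys‖ := norm_nonneg _
  have hmem := (hsol.app_mem hS.primal hS.dual hind).1
  have hxs := hsol.primal_ne_top hS.primal hS.dual
  -- All saddle points share the value of `g`, so the comparison point `x` may vary while the noise
  -- is still bounded through `(xs, ys)`. The infimum over `(x, y)` then produces `distSol`.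
  have key : ∀ x y, IsSaddle A g hs x y →
      ∫ ω, |(g ((importanceParams A g hs γ x₀ y₀).xAvg (fun j => I j ω) K)).toReal
        - (g xs).toReal| ∂P
      ≤ 8 * R / (K * γ * (1 - γ)) * ((‖xs - x₀‖ + ‖ys - y₀‖ + ‖y₀‖ + ‖ys‖) * ‖ys‖
        + (‖x - x₀‖ ^ 2 + ‖y - y₀‖ ^ 2) + ‖y₀‖ ^ 2) := by
    intro x y hxy
    have hx := hxy.primal_ne_top hS.primal hS.dual
    have hmem' := (hxy.app_mem hS.primal hS.dual hind).1
    have hval : (g x).toReal = (g xs).toReal :=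
      le_antisymm (hxy.primal_value_le hS.primal hS.dual hind hxs hmem)
        (hsol.primal_value_le hS.primal hS.dual hind hx hmem')
    have h := hS.expected_gap hI hindep hlaw hsol hK hx
      -- One multiple of `‖ys‖ * dist` offsets the possible negativity of `g u - g xs`; the second
      -- bounds the absolute value.
      (c := 0) (fun y hy => inner_le_of_mem hS.dual hind hmem' hy) (ρ := 2 * ‖ys‖)
      (ρ' := 2 * ‖ys‖ + ‖y₀‖) (by positivity) (T := fun u => |(g u).toReal - (g xs).toReal|)
      (fun u B hu hB => by
        obtain ⟨v, hv, hvr, hvd⟩ := exists_dual_infDist hS.dual hne hconv hcl hind (app A u)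
          (r := 2 * ‖ys‖) (by positivity)
        have h1 := hB v hv hvr ((norm_sub_le _ _).trans (by linarith))
        have h2 := hsol.neg_mul_infDist_le hS.primal hS.dual hne hconv hcl hind hu
        have h3 : 0 ≤ ‖ys‖ * Metric.infDist (app A u) C :=
          mul_nonneg hb0 Metric.infDist_nonneg
        rw [hval] at h1
        exact abs_le.2 ⟨by linarith, by linarith⟩)
    refine h.trans ?_
    set X := ‖xs - x₀‖
    set Y := ‖ys - y₀‖
    set a := ‖y₀‖
    set b := ‖ys‖
    set X' := ‖x - x₀‖
    set Y' := ‖y - y₀‖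
    have e : R / (2 * γ * K) * (γ * X' ^ 2 + (2 * b + a) ^ 2 + 2 * (2 * b) * ((X + Y) / (1 - γ)))
        = R / (2 * γ * K * (1 - γ)) *
          ((1 - γ) * (γ * X' ^ 2 + (2 * b + a) ^ 2) + 4 * (b * (X + Y))) := by
      field_simp; ring
    have e2 : 8 * R / (K * γ * (1 - γ)) * ((X + Y + a + b) * b + (X' ^ 2 + Y' ^ 2) + a ^ 2)
        = R / (2 * γ * K * (1 - γ)) *
          (16 * ((X + Y + a + b) * b + (X' ^ 2 + Y' ^ 2) + a ^ 2)) := by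
      field_simp; ring
    rw [e, e2]
    refine mul_le_mul_of_nonneg_left ?_ (by positivity)
    have h4 : γ * X' ^ 2 ≤ X' ^ 2 := mul_le_of_le_one_left (sq_nonneg _) hS.γ_lt.le
    have h5 : (1 - γ) * (γ * X' ^ 2 + (2 * b + a) ^ 2) ≤ γ * X' ^ 2 + (2 * b + a) ^ 2 :=
      mul_le_of_le_one_left (by positivity) (by linarith)
    nlinarith [mul_nonneg hb0 hX0, mul_nonneg hb0 hY0, mul_nonneg hb0 ha0, sq_nonneg X',
      sq_nonneg Y', sq_nonneg a, sq_nonneg b]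
  have hQ : 0 < 8 * R / (K * γ * (1 - γ)) := by positivity
  set Q := 8 * R / (K * γ * (1 - γ))
  rw [← div_le_iff₀' hQ]
  have hinf : (∫ ω, |(g ((importanceParams A g hs γ x₀ y₀).xAvg (fun j => I j ω) K)).toReal
      - (g xs).toReal| ∂P) / Q - (‖xs - x₀‖ + ‖ys - y₀‖ + ‖y₀‖ + ‖ys‖) * ‖ys‖ - ‖y₀‖ ^ 2
      ≤ distSol A g hs x₀ y₀ := by
    refine le_csInf ⟨_, xs, ys, hsol, rfl⟩ ?_
    rintro r ⟨x, y, hxy, rfl⟩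
    have := key x y hxy
    rw [← div_le_iff₀' hQ] at this
    linarith
  linarith

end Rates

end PureCD

theorem mainTheorem1 {n d : ℕ} (A : Matrix (Fin n) (Fin d) ℝ) (hA : ∀ i, A i ≠ 0)
    (g : EuclideanSpace ℝ (Fin d) → EReal) (hs : Fin n → ℝ → EReal)
    (hg : PureCD.ProperConvexLsc g) (hhs : PureCD.ProperConvexLsc (PureCD.separable hs))
    (x₀ : EuclideanSpace ℝ (Fin d)) (hx₀ : g x₀ ≠ ⊤)
    (y₀ : EuclideanSpace ℝ (Fin n)) (hy₀ : PureCD.separable hs y₀ ≠ ⊤)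
    (γ : ℝ) (hγ₀ : 0 < γ) (hγ₁ : γ < 1)
    {Ω : Type*} [MeasurableSpace Ω] (P : Measure Ω) [IsProbabilityMeasure P]
    (I : ℕ → Ω → Fin n) (hI : ∀ k, Measurable (I k)) (hindep : iIndepFun I P)
    (hlaw : ∀ k i, P.real {ω | I k ω = i} =
      PureCD.rowNorm A i / ∑ j, PureCD.rowNorm A j)
    (xs : EuclideanSpace ℝ (Fin d)) (ys : EuclideanSpace ℝ (Fin n))
    (hsol : PureCD.IsSaddle A g hs xs ys) (K : ℕ) (hK : 1 ≤ K)
    (R : ℝ) (hR : R = ∑ j, PureCD.rowNorm A j)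
    (h : EuclideanSpace ℝ (Fin n) → EReal)
    (hh : h = PureCD.separable fun i => PureCD.conj (hs i))
    (xK : Ω → EuclideanSpace ℝ (Fin d))
    (hxK : ∀ ω, xK ω =
      (PureCD.importanceParams A g hs γ x₀ y₀).xAvg (fun k => I k ω) K) :
    -- all the objective values below are finite
    (g xs ≠ ⊤ ∧ ∀ ω, g (xK ω) ≠ ⊤) ∧
    -- Case 1
    (∀ Lh : ℝ≥0, PureCD.IsLipschitzReal Lh h →
      Integrable (fun ω => (h (PureCD.app A (xK ω))).toReal + (g (xK ω)).toReal
        - (h (PureCD.app A xs)).toReal - (g xs).toReal) P ∧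
      ∫ ω, ((h (PureCD.app A (xK ω))).toReal + (g (xK ω)).toReal
        - (h (PureCD.app A xs)).toReal - (g xs).toReal) ∂P
        ≤ 2 * R / (K * γ * (1 - γ)) * (4 * (Lh : ℝ) ^ 2 + ‖xs - x₀‖ ^ 2)) ∧
    -- Case 2
    (∀ (C : Set (EuclideanSpace ℝ (Fin n))) (Cs : Fin n → Set ℝ),
      C = {z | ∀ i, z i ∈ Cs i} → C.Nonempty → Convex ℝ C → IsClosed C →
      h = PureCD.indicator C →
      (Integrable (fun ω => |(g (xK ω)).toReal - (g xs).toReal|) P ∧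
        ∫ ω, |(g (xK ω)).toReal - (g xs).toReal| ∂P
          ≤ 8 * R / (K * γ * (1 - γ)) *
            ((‖xs - x₀‖ + ‖ys - y₀‖ + ‖y₀‖ + ‖ys‖) * ‖ys‖ +
              PureCD.distSol A g hs x₀ y₀ + ‖y₀‖ ^ 2)) ∧
      (Integrable (fun ω => Metric.infDist (PureCD.app A (xK ω)) C) P ∧
        ∫ ω, Metric.infDist (PureCD.app A (xK ω)) C ∂P
          ≤ 8 * R / (K * γ * (1 - γ)) *
            (‖xs - x₀‖ + ‖ys - y₀‖ + ‖y₀‖ + ‖ys‖))) := by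
  subst hR
  subst hh
  -- A sample point provides the pick `I 0 ω₀`, so there is at least one row and the sum of row
  -- norms is positive.
  obtain ⟨ω₀⟩ := nonempty_of_isProbabilityMeasure P
  have hS : PureCD.Admissible A g hs γ (∑ j, PureCD.rowNorm A j) :=
    ⟨hA, hg, hhs, hγ₀, hγ₁, rfl, Finset.sum_pos (fun i _ => PureCD.rowNorm_pos hA i)
      ⟨I 0 ω₀, Finset.mem_univ _⟩⟩
  have hint : ∀ T : EuclideanSpace ℝ (Fin d) → ℝ, Integrable (fun ω => T (xK ω)) P := by
    intro T
    simp only [hxK]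
    exact PureCD.integrable_path
      (F := fun s => T ((PureCD.importanceParams A g hs γ x₀ y₀).xAvg s K)) hI
      fun _ _ hst => congrArg T
        ((PureCD.importanceParams A g hs γ x₀ y₀).dependsOn_xAvg K hst)
  refine ⟨⟨hsol.primal_ne_top hg hhs, fun ω => ?_⟩, fun Lh hL => ⟨hint fun u =>
    (PureCD.separable (fun i => PureCD.conj (hs i)) (PureCD.app A u)).toReal + (g u).toReal
      - (PureCD.separable (fun i => PureCD.conj (hs i)) (PureCD.app A xs)).toReal
      - (g xs).toReal, ?_⟩, fun C Cs _ hne hconv hcl hind =>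
    ⟨⟨hint fun u => |(g u).toReal - (g xs).toReal|, ?_⟩,
      hint fun u => Metric.infDist (PureCD.app A u) C, ?_⟩⟩
  · rw [hxK]
    exact (hS.xAvg_convex _ hK).1
  · simp only [hxK]
    exact hS.lipschitz_rate hI hindep hlaw hsol hK hy₀ hL fun _ => rfl
  · simp only [hxK]
    exact hS.value_rate hI hindep hlaw hsol hK hne hconv hcl hind
  · simp only [hxK]
    exact hS.infDist_rate hI hindep hlaw hsol hK hne hconv hcl hind
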